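/- **Setting.** Let $s,m,d,p,L\in\mathbb N$ with $p<d$, let $t_0\in\mathbb R$, $a,b>0$, $T=[t_0-a,t_0+b]$, and let $S\subset\mathbb R^s$ be compact with $\mathring S$ dense in $S$. For $z=(z_1,\dots,z_m)\in\mathbb R^m$ put $|z|=\max_h|z_h|$. For a set $X$ with dense interior, $f\in\mathcal C^\infty(X)$ means that $f$ is continuous on $X$, smooth in $\mathring X$, and all its derivatives extend continuously from $\mathring X$ to $X$. Write $\mathcal C_t^p\mathcal C_x^\infty$ for the space of continuous $y:T\times S\to\mathbb R^m$ whose derivatives $\partial_t^\gamma\partial_x^\alpha y$, $\gamma\le p$, $\alpha\in\mathbb N^s$, exist in the interior of $T\times S$ (independently of the order of differentiation) and extend continuously to $T\times S$. At points of $T\times S$ that are not interior, derivatives are the values of these extensions. For $k\in\mathbb N$ set $$\|y\|_k=\max_{\gamma\le p,\ \gamma+|\alpha|\le k}\ \max_{T\times S}|\partial_x^\alpha\partial_t^\gamma y|,\qquad |||y|||_k=\max_{\gamma\le p,\ |\alpha|\le k}\ \max_{T\times S}|\partial_x^\alpha\partial_t^\gamma y| ,$$ so that $\|y\|_k\le|||y|||_k\le\|y\|_{k+p}$,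 with equality throughout if $p=0$. The space $\mathcal C_t^p\mathcal C_x^\infty$ carries the topology of the norms $\|\cdot\|_k$. Let $F=F[t,x,(z^{\alpha,\gamma})_{|\alpha|\le L,\gamma\le p}]$, $z^{\alpha,\gamma}\in\mathbb R^m$, be an $\mathbb R^m$-valued $\mathcal C^\infty$ function of $(t,x)\in T\times S$ and of arbitrary $z^{\alpha,\gamma}$, and let $y_{00},\dots,y_{0,d-1}\in\mathcal C^\infty(S,\mathbb R^m)$. Put $$i_0(t,x)=\sum_{j=0}^{d-1}\frac{y_{0j}(x)}{j!}(t-t_0)^j,\qquad G(t,x,y)=F\big[t,x,(\partial_x^\alpha\partial_t^\gamma y(t,x))_{|\alpha|\le L,\gamma\le p}\big].$$ For $r_k\in(0,+\infty]$, $R=(r_k)_{k\in\mathbb N}$, let $\bar B_R(i_0)=\{u\in\mathcal C_t^p\mathcal C_x^\infty:\ \|u-i_0\|_k\le r_k\ \forall k\}$. For a function $f$ write $I_j[f](t,x)=\int_{t_0}^t ds_j\int_{t_0}^{s_j}ds_{j-1}\cdots\int_{t_0}^{s_2}f(s_1,x)\,ds_1$ ($j$ integrals), and put $P(y)=i_0+I_d[G(\cdot,\cdot,y)]$.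 **Lipschitz condition.** Let $\Lambda_k\in\mathcal C^0(T\times S)$, $k\in\mathbb N$, and assume that $G$ is Lipschitz on $\bar B_R(i_0)$ with loss of derivatives $L$ and factors $(\Lambda_k)$. That is, $G(\cdot,\cdot,u)\in\mathcal C_t^0\mathcal C_x^\infty$ for $u\in\bar B_R(i_0)$, and for all $k$, all $|\nu|\le k$, all $u,v\in\bar B_R(i_0)$ and all $(t,x)\in T\times S$ $$|\partial_x^\nu G(t,x,u)-\partial_x^\nu G(t,x,v)|\le\Lambda_k(t,x)\max_{|\alpha|\le k+L,\ \gamma\le p}|\partial_x^\alpha\partial_t^\gamma(u-v)(t,x)| .$$ For $1\le j\le d$ set $\Lambda^j_{k,0}=1$, $$\Lambda^j_{k,n+1}=\Big|I_j\big[\Lambda_k\cdot\max_{0<l\le d}\Lambda^l_{k+L,n}\big]\Big| ,\qquad \bar\Lambda_{k,n}=\max_{0<j\le d}\ \max_{(t,x)\in T\times S}\Lambda^j_{k,n}(t,x).$$ **Theorem (Picard–Lindelöf theorem for smooth normal PDE).** $P$ maps $\bar B_R(i_0)$ into $\mathcal C_t^p\mathcal C_x^\infty$, and the following hold. 1. Assume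 that (i) $P^n(i_0)\in\bar B_R(i_0)$ for all $n\in\mathbb N$, and (ii) $\sum_{n=0}^{+\infty}\bar\Lambda_{k,n}\,|||P(i_0)-i_0|||_{k+nL}<+\infty$ for all $k\in\mathbb N$. Then there is $y\in\bar B_R(i_0)\cap\mathcal C^\infty(T\times S,\mathbb R^m)$ with $$\partial_t^dy(t,x)=F\big[t,x,(\partial_x^\alpha\partial_t^\gamma y(t,x))_{|\alpha|\le L,\gamma\le p}\big]\ \text{ on } T\times S,\qquad \partial_t^jy(t_0,x)=y_{0j}(x)\ \ (x\in S,\ 0\le j<d),$$ such that $P^n(i_0)\to y$ in $\mathcal C_t^p\mathcal C_x^\infty$ and, for all $k,N\in\mathbb N$, $$\|y-P^N(i_0)\|_k\le|||y-P^N(i_0)|||_k\le\sum_{n=N}^{+\infty}\bar\Lambda_{k,n}\,|||P(i_0)-i_0|||_{k+nL}.$$ 2. Let $M_k\in\mathcal C^0(T\times S)$, $\bar M_{k,j}=|I_j[M_k]|$, and assume for all $k$ that (iii) $|\partial_x^\nu G(t,x,u)|\le M_k(t,x)$ for all $u\in\bar B_R(i_0)$, $(t,x)\in T\times S$ and $|\nu|\le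 k$, and (iv) $\max_{0<j\le d}\max_{(t,x)\in T\times S}\bar M_{k,j}(t,x)\le r_k$. Then $P$ maps $\bar B_R(i_0)$ into itself, and hence (i) holds. -/

import Mathlib

open Set Filter Topology
open scoped ENNReal NNReal ContDiff

noncomputable section

/-! ### Smooth functions on a set, up to the boundary -/

/-- `f ∈ C^∞(Ω)` for a set `Ω` contained in the closure of its interior: `f` is continuous on `Ω`,
smooth in the interior of `Ω`, and each of its derivatives extends continuously from the interior
to `Ω`. -/
def SmoothUpTo {E F : Type*} [NormedAddCommGroup E] [NormedSpace ℝ E]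
    [NormedAddCommGroup F] [NormedSpace ℝ F] (Ω : Set E) (f : E → F) : Prop :=
  ContinuousOn f Ω ∧ ContDiffOn ℝ ∞ f (interior Ω) ∧
    ∀ n : ℕ, ∃ g : E → ContinuousMultilinearMap ℝ (fun _ : Fin n => E) F,
      ContinuousOn g Ω ∧ EqOn g (iteratedFDeriv ℝ n f) (interior Ω)

/-! ### Partial derivatives of functions of `(t, x)`

Points are pairs `(t, x) : ℝ × (Fin s → ℝ)`, values lie in `Fin m → ℝ` with the maximum norm, and
a multi-index `β ∈ ℕ^{1+s}` is a pair `(γ, α) : ℕ × (Fin s → ℕ)`. -/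

/-- The partial derivative `∂_t f`. -/
def partialT {s m : ℕ} (f : ℝ × (Fin s → ℝ) → (Fin m → ℝ)) : ℝ × (Fin s → ℝ) → (Fin m → ℝ) :=
  fun z => deriv (fun τ => f (τ, z.2)) z.1

/-- The partial derivative `∂_{x_i} f`. -/
def partialX {s m : ℕ} (i : Fin s) (f : ℝ × (Fin s → ℝ) → (Fin m → ℝ)) :
    ℝ × (Fin s → ℝ) → (Fin m → ℝ) :=
  fun z => deriv (fun ξ => f (z.1, Function.update z.2 i ξ)) (z.2 i)

/-- The iterated partial derivative `∂_x^α ∂_t^γ f`, where `β = (γ, α)`. -/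
def partialDeriv {s m : ℕ} (β : ℕ × (Fin s → ℕ)) (f : ℝ × (Fin s → ℝ) → (Fin m → ℝ)) :
    ℝ × (Fin s → ℝ) → (Fin m → ℝ) :=
  (List.finRange s).foldr (fun i g => (partialX i)^[β.2 i] g) (partialT^[β.1] f)

/-- The derivative `∂^β f` as a function on `Ω`: the iterated partial derivative in the interior
of `Ω`, continued to the points of `Ω` by its limits from the interior. -/
def derivOn {s m : ℕ} (Ω : Set (ℝ × (Fin s → ℝ))) (β : ℕ × (Fin s → ℕ))
    (f : ℝ × (Fin s → ℝ) → (Fin m → ℝ)) : ℝ × (Fin s → ℝ) → (Fin m → ℝ) :=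
  extendFrom (interior Ω) (partialDeriv β f)

/-- `f ∈ C_t^p C_x^∞(Ω, ℝ^m)`: for every `β = (γ, α)` with `γ ≤ p` there is a continuous function
`D β` on `Ω` such that `D 0 = f` and, in the interior of `Ω`, `∂_t D (γ, α) = D (γ + 1, α)` and
`∂_{x_i} D (γ, α) = D (γ, α + e_i)`; that is, `D β` is the derivative `∂^β f`. -/
def SepRegular {s m : ℕ} (Ω : Set (ℝ × (Fin s → ℝ))) (p : ℕ)
    (f : ℝ × (Fin s → ℝ) → (Fin m → ℝ)) : Prop :=
  ∃ D : ℕ × (Fin s → ℕ) → ℝ × (Fin s → ℝ) → (Fin m → ℝ),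
    EqOn (D 0) f Ω ∧
    (∀ γ α, γ ≤ p → ContinuousOn (D (γ, α)) Ω) ∧
    (∀ γ α, γ < p → ∀ z ∈ interior Ω,
      HasDerivAt (fun τ => D (γ, α) (τ, z.2)) (D (γ + 1, α) z) z.1) ∧
    (∀ γ α, γ ≤ p → ∀ i, ∀ z ∈ interior Ω,
      HasDerivAt (fun ξ => D (γ, α) (z.1, Function.update z.2 i ξ))
        (D (γ, α + Pi.single i 1) z) (z.2 i))

/-! ### Norms -/

/-- The multi-indices `α ∈ ℕ^s` with `|α| ≤ K`. -/
def spaceIdx (s K : ℕ) : Finset (Fin s → ℕ) :=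
  (Fintype.piFinset fun _ => Finset.range (K + 1)).filter fun α => ∑ i, α i ≤ K

/-- The pairs `(γ, α)` with `γ ≤ p` and `|α| ≤ K`. -/
def jetIdx (s p K : ℕ) : Finset (ℕ × (Fin s → ℕ)) :=
  Finset.range (p + 1) ×ˢ spaceIdx s K

/-- `‖y‖_k`, the maximum over `Ω` of `|∂^β y^h|`, `1 ≤ h ≤ m`, `β = (γ, α)`, `γ ≤ p`,
`γ + |α| ≤ k`. -/
def gradedNorm {s m : ℕ} (Ω : Set (ℝ × (Fin s → ℝ))) (p k : ℕ)
    (y : ℝ × (Fin s → ℝ) → (Fin m → ℝ)) : ℝ≥0∞ :=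
  ⨆ β ∈ {β : ℕ × (Fin s → ℕ) | β.1 ≤ p ∧ β.1 + ∑ i, β.2 i ≤ k}, ⨆ z ∈ Ω, ‖derivOn Ω β y z‖ₑ

/-- `|||y|||_k`, the maximum over `Ω` of `|∂_x^α ∂_t^γ y^h|`, `1 ≤ h ≤ m`, `γ ≤ p`, `|α| ≤ k`
(only the derivatives in `x` are counted by `k`). -/
def spaceNorm {s m : ℕ} (Ω : Set (ℝ × (Fin s → ℝ))) (p k : ℕ)
    (y : ℝ × (Fin s → ℝ) → (Fin m → ℝ)) : ℝ≥0∞ :=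
  ⨆ β ∈ jetIdx s p k, ⨆ z ∈ Ω, ‖derivOn Ω β y z‖ₑ

/-- The closed ball `B̄_R(i₀)` of `C_t^p C_x^∞(Ω, ℝ^m)`, where `R = (r_k)`. -/
def gradedBall {s m : ℕ} (Ω : Set (ℝ × (Fin s → ℝ))) (p : ℕ) (r : ℕ → ℝ≥0∞)
    (i₀ : ℝ × (Fin s → ℝ) → (Fin m → ℝ)) : Set (ℝ × (Fin s → ℝ) → (Fin m → ℝ)) :=
  {u | SepRegular Ω p u ∧ ∀ k, gradedNorm Ω p k (u - i₀) ≤ r k}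

/-! ### The Cauchy problem and the Picard operator -/

/-- The `j`-fold iterated integral `t ↦ ∫_{t₀}^t ds_j ⋯ ∫_{t₀}^{s_2} f(s_1) ds_1`. -/
def iterInt {E : Type*} [NormedAddCommGroup E] [NormedSpace ℝ E] (t₀ : ℝ) :
    ℕ → (ℝ → E) → ℝ → E
  | 0, f => f
  | j + 1, f => fun t => ∫ σ in t₀..t, iterInt t₀ j f σ

/-- `T × S` with `T = [t₀ - a, t₀ + b]`. -/
def cylinder {s : ℕ} (t₀ a b : ℝ) (S : Set (Fin s → ℝ)) : Set (ℝ × (Fin s → ℝ)) :=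
  Icc (t₀ - a) (t₀ + b) ×ˢ S

/-- The set `T × S × ℝ^{m·L̂}` on which the right-hand side `F` is given. -/
def rhsDomain {s : ℕ} (m p L : ℕ) (t₀ a b : ℝ) (S : Set (Fin s → ℝ)) :
    Set (ℝ × (Fin s → ℝ) × (jetIdx s p L → (Fin m → ℝ))) :=
  Icc (t₀ - a) (t₀ + b) ×ˢ S ×ˢ univ

/-- `i₀(t, x) = ∑_{j<d} y_{0j}(x) (t - t₀)^j / j!`. -/
def initialPoly {s m d : ℕ} (t₀ : ℝ) (y₀ : Fin d → (Fin s → ℝ) → (Fin m → ℝ)) :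
    ℝ × (Fin s → ℝ) → (Fin m → ℝ) :=
  fun z => ∑ j : Fin d, ((z.1 - t₀) ^ (j : ℕ) / ((j : ℕ).factorial : ℝ)) • y₀ j z.2

/-- `G(t, x, y) = F[t, x, (∂_x^α ∂_t^γ y(t, x))_{|α| ≤ L, γ ≤ p}]`. -/
def rhs {s m p L : ℕ} (Ω : Set (ℝ × (Fin s → ℝ)))
    (F : ℝ × (Fin s → ℝ) × (jetIdx s p L → (Fin m → ℝ)) → (Fin m → ℝ))
    (y : ℝ × (Fin s → ℝ) → (Fin m → ℝ)) : ℝ × (Fin s → ℝ) → (Fin m → ℝ) :=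
  fun z => F (z.1, z.2, fun β => derivOn Ω β y z)

/-- `P(y)(t, x) = i₀(t, x) + ∫_{t₀}^t ds_d ⋯ ∫_{t₀}^{s_2} G(s_1, x, y) ds_1` (`d` integrals). -/
def picard {s m : ℕ} (t₀ : ℝ) (d : ℕ) (i₀ : ℝ × (Fin s → ℝ) → (Fin m → ℝ))
    (G : (ℝ × (Fin s → ℝ) → (Fin m → ℝ)) → ℝ × (Fin s → ℝ) → (Fin m → ℝ))
    (y : ℝ × (Fin s → ℝ) → (Fin m → ℝ)) : ℝ × (Fin s → ℝ) → (Fin m → ℝ) :=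
  fun z => i₀ z + iterInt t₀ d (fun σ => G y (σ, z.2)) z.1

/-- `G` is Lipschitz on `B` with loss of derivatives `L` and Lipschitz factors `Λ`.
(For `G = rhs Ω F` with `F` smooth, the first condition holds for every `y ∈ C_t^p C_x^∞`.) -/
def LipschitzLOD {s m : ℕ} (Ω : Set (ℝ × (Fin s → ℝ))) (p L : ℕ)
    (B : Set (ℝ × (Fin s → ℝ) → (Fin m → ℝ)))
    (G : (ℝ × (Fin s → ℝ) → (Fin m → ℝ)) → ℝ × (Fin s → ℝ) → (Fin m → ℝ))
    (Λ : ℕ → ℝ × (Fin s → ℝ) → ℝ) : Prop :=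
  (∀ y ∈ B, SepRegular Ω 0 (G y)) ∧
  (∀ k, ContinuousOn (Λ k) Ω) ∧
  ∀ k, ∀ ν ∈ spaceIdx s k, ∀ u ∈ B, ∀ v ∈ B, ∀ z ∈ Ω,
    ‖derivOn Ω (0, ν) (G u) z - derivOn Ω (0, ν) (G v) z‖ ≤
      Λ k z * (((jetIdx s p (k + L)).sup fun β => ‖derivOn Ω β (u - v) z‖₊ : ℝ≥0) : ℝ)

/-- `lipIter t₀ d L Λ n k j` is `Λ_{k,n}^j`:  `Λ_{k,0}^j = 1` and `Λ_{k,n+1}^j(t, x)` is the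
absolute value of the `j`-fold integral of `Λ_k · max_{0<l≤d} Λ_{k+L,n}^l`. -/
def lipIter {s : ℕ} (t₀ : ℝ) (d L : ℕ) (Λ : ℕ → ℝ × (Fin s → ℝ) → ℝ) :
    ℕ → ℕ → ℕ → ℝ × (Fin s → ℝ) → ℝ
  | 0, _, _ => fun _ => 1
  | n + 1, k, j => fun z =>
      |iterInt t₀ j
        (fun σ => Λ k (σ, z.2) * ⨆ l : Fin d, lipIter t₀ d L Λ n (k + L) (l.val + 1) (σ, z.2)) z.1|

/-- `Λ̄_{k,n}`, the maximum over `Ω` and over `0 < j ≤ d` of `Λ_{k,n}^j`. -/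
def lipBar {s : ℕ} (Ω : Set (ℝ × (Fin s → ℝ))) (t₀ : ℝ) (d L : ℕ)
    (Λ : ℕ → ℝ × (Fin s → ℝ) → ℝ) (k n : ℕ) : ℝ≥0∞ :=
  ⨆ z ∈ Ω, ⨆ j : Fin d, ENNReal.ofReal (lipIter t₀ d L Λ n k (j.val + 1) z)

/-- `M̄_{k,j}(t, x)`, the absolute value of the `j`-fold integral of `M = M_k`. -/
def boundIter {s : ℕ} (t₀ : ℝ) (M : ℝ × (Fin s → ℝ) → ℝ) (j : ℕ) (z : ℝ × (Fin s → ℝ)) : ℝ :=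
  |iterInt t₀ j (fun σ => M (σ, z.2)) z.1|

/-- `y` solves `∂_t^d y = F[t, x, (∂_x^α ∂_t^γ y)]` on `T × S` with `∂_t^j y(t₀, x) = y_{0j}(x)`
for `x ∈ S` and `j < d`. -/
def IsCauchySolution {s m d p L : ℕ} (t₀ a b : ℝ) (S : Set (Fin s → ℝ))
    (F : ℝ × (Fin s → ℝ) × (jetIdx s p L → (Fin m → ℝ)) → (Fin m → ℝ))
    (y₀ : Fin d → (Fin s → ℝ) → (Fin m → ℝ))
    (y : ℝ × (Fin s → ℝ) → (Fin m → ℝ)) : Prop :=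
  (∀ z ∈ cylinder t₀ a b S,
    derivOn (cylinder t₀ a b S) (d, 0) y z = rhs (cylinder t₀ a b S) F y z) ∧
  ∀ j : Fin d, ∀ x ∈ S, derivOn (cylinder t₀ a b S) (j, 0) y (t₀, x) = y₀ j x

end

/-!
For a function `g` of class `C_t^0 C_x^∞` on `Ω = T × S` one has
`∂_x^α ∂_t^γ I_d[g] = I_{d-γ}[∂_x^α g]` for all `γ ≤ d` (`IsJet.iterIntT`), so the Picard operator
`P(u) = i₀ + I_d[G(u)]` produces functions with `d > p` time derivatives, and derivatives of
`P(u) - P(v)` are iterated integrals of the space derivatives of `G(u) - G(v)`. Inserting the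
Lipschitz condition and iterating, the increments of the Picard iterates are bounded by
`|||P^{n+1}(i₀) - P^n(i₀)|||_k ≤ Λ̄_{k,n} |||P(i₀) - i₀|||_{k+nL}`: each step costs `L` space
derivatives and one more integration (`spaceNorm_picard_iterate_sub_le`). The summability hypothesis
makes the iterates converge in every norm (`exists_limit_of_summable_increments`); the limit lies in
the ball, which is closed, and is a fixed point of `P` (`tendsto_picard`), hence a solution
(`isCauchySolution_of_fixedPoint`).

The estimate uses that the Lipschitz factors are nonnegative. This is not assumed, but it can fail
only if all elements of the ball agree with `i₀` on `Ω`, and then the increments vanish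
(`lipschitz_nonneg_or_ball_trivial`).

The fixed point has `d` time derivatives and all space derivatives. That it is smooth in `(t, x)`
follows from the equation: the space derivatives of `F[t, x, (∂^β y)]` are smooth functions of
`(t, x)` and of finitely many derivatives of `y` of time order `≤ p < d` (`exists_prolongation`), so
if all `∂_x^α ∂_t^γ y` with `γ ≤ d` are of class `C^n`, then those with `γ < d` are of class
`C^{n+1}`, having partial derivatives of class `C^n`, and by the equation so are those with `γ = d`
(`smoothUpTo_of_isJet`). Regularity up to the boundary is carried along by means of continuous
extensions from the interior (`CkUpTo`): for a general compact `S` a function with such extensions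
need not be differentiable at the boundary points within `Ω`.
-/

/-! ### Jets of functions of class `C_t^p C_x^∞` -/

/-- `D` is the family of derivatives `∂_x^α ∂_t^γ f`, `γ ≤ p`, of a function `f` of class
`C_t^p C_x^∞` on `Ω`; the entries `D (γ, α)` with `γ > p` are arbitrary. -/
def IsJet {s m : ℕ} (Ω : Set (ℝ × (Fin s → ℝ))) (p : ℕ)
    (f : ℝ × (Fin s → ℝ) → (Fin m → ℝ))
    (D : ℕ × (Fin s → ℕ) → ℝ × (Fin s → ℝ) → (Fin m → ℝ)) : Prop :=
  EqOn (D 0) f Ω ∧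
    (∀ γ α, γ ≤ p → ContinuousOn (D (γ, α)) Ω) ∧
    (∀ γ α, γ < p → ∀ z ∈ interior Ω,
      HasDerivAt (fun τ => D (γ, α) (τ, z.2)) (D (γ + 1, α) z) z.1) ∧
    (∀ γ α, γ ≤ p → ∀ i, ∀ z ∈ interior Ω,
      HasDerivAt (fun ξ => D (γ, α) (z.1, Function.update z.2 i ξ))
        (D (γ, α + Pi.single i 1) z) (z.2 i))

section Jets

variable {s m : ℕ} {Ω U : Set (ℝ × (Fin s → ℝ))} {p q : ℕ}
  {f g : ℝ × (Fin s → ℝ) → (Fin m → ℝ)}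
  {D E : ℕ × (Fin s → ℕ) → ℝ × (Fin s → ℝ) → (Fin m → ℝ)}

theorem sepRegular_iff : SepRegular Ω p f ↔ ∃ D, IsJet Ω p f D := Iff.rfl

theorem tendsto_lineT (z : ℝ × (Fin s → ℝ)) :
    Tendsto (fun τ : ℝ => (τ, z.2)) (𝓝 z.1) (𝓝 z) :=
  (Continuous.prodMk_left z.2).tendsto' _ _ rfl

theorem tendsto_lineX (i : Fin s) (z : ℝ × (Fin s → ℝ)) :
    Tendsto (fun ξ : ℝ => (z.1, Function.update z.2 i ξ)) (𝓝 (z.2 i)) (𝓝 z) := by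
  have : Continuous fun ξ : ℝ => (z.1, Function.update z.2 i ξ) := by fun_prop
  exact this.tendsto' _ _ (by simp)

theorem eqOn_partialT (hU : IsOpen U) (h : EqOn f g U) : EqOn (partialT f) (partialT g) U := by
  intro z hz
  apply EventuallyEq.deriv_eq
  filter_upwards [(tendsto_lineT z).eventually (hU.mem_nhds hz)] with τ hτ using h hτ

theorem eqOn_partialX (hU : IsOpen U) (i : Fin s) (h : EqOn f g U) :
    EqOn (partialX i f) (partialX i g) U := by
  intro z hz
  apply EventuallyEq.deriv_eq
  filter_upwards [(tendsto_lineX i z).eventually (hU.mem_nhds hz)] with τ hτ using h hτ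

namespace IsJet

theorem eqOn_iterate_partialT (h : IsJet Ω p f D) {γ : ℕ} (hγ : γ ≤ p) :
    EqOn (partialT^[γ] f) (D (γ, 0)) (interior Ω) := by
  induction γ with
  | zero => exact fun z hz => (h.1 (interior_subset hz)).symm
  | succ γ ih =>
    rw [Function.iterate_succ_apply']
    refine (eqOn_partialT isOpen_interior (ih (by lia))).trans fun z hz => ?_
    exact (h.2.2.1 γ 0 (by lia) z hz).deriv

theorem eqOn_iterate_partialX (h : IsJet Ω p f D) {γ : ℕ} (hγ : γ ≤ p) {α : Fin s → ℕ}
    (hg : EqOn g (D (γ, α)) (interior Ω)) (i : Fin s) (n : ℕ) :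
    EqOn ((partialX i)^[n] g) (D (γ, n • Pi.single i 1 + α)) (interior Ω) := by
  induction n with
  | zero => simpa using hg
  | succ n ih =>
    rw [Function.iterate_succ_apply']
    refine (eqOn_partialX isOpen_interior i ih).trans fun z hz => ?_
    rw [succ_nsmul, add_right_comm]
    exact (h.2.2.2 γ _ hγ i z hz).deriv

theorem eqOn_partialDeriv (h : IsJet Ω p f D) {β : ℕ × (Fin s → ℕ)} (hβ : β.1 ≤ p) :
    EqOn (partialDeriv β f) (D β) (interior Ω) := by
  have key : ∀ l : List (Fin s),
      EqOn (l.foldr (fun i g => (partialX i)^[β.2 i] g) (partialT^[β.1] f))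
        (D (β.1, (l.map fun i => β.2 i • (Pi.single i 1 : Fin s → ℕ)).sum)) (interior Ω) := by
    intro l
    induction l with
    | nil => exact h.eqOn_iterate_partialT hβ
    | cons i l ih => exact h.eqOn_iterate_partialX hβ ih i _
  have hs : ((List.finRange s).map fun i => β.2 i • (Pi.single i 1 : Fin s → ℕ)).sum = β.2 := by
    rw [← Fin.sum_univ_def]
    ext j
    simp [Finset.sum_apply, Pi.single_apply]
  simpa only [hs] using! key (List.finRange s)

/-- The derivatives of `f`, continued to `Ω`, are the entries of any jet of `f`. -/
theorem derivOn_eq (h : IsJet Ω p f D) (hΩ : Ω ⊆ closure (interior Ω))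
    {β : ℕ × (Fin s → ℕ)} (hβ : β.1 ≤ p) : EqOn (derivOn Ω β f) (D β) Ω := by
  intro z hz
  apply extendFrom_eq (hΩ hz)
  have := ((h.2.1 β.1 β.2 hβ) z hz).mono_left (nhdsWithin_mono z interior_subset)
  refine this.congr' ?_
  filter_upwards [self_mem_nhdsWithin] with w hw using (h.eqOn_partialDeriv hβ hw).symm

theorem mono (h : IsJet Ω p f D) (hq : q ≤ p) : IsJet Ω q f D :=
  ⟨h.1, fun γ α hγ => h.2.1 γ α (hγ.trans hq), fun γ α hγ => h.2.2.1 γ α (hγ.trans_le hq),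
    fun γ α hγ => h.2.2.2 γ α (hγ.trans hq)⟩

theorem congr (h : IsJet Ω p f D) (hfg : EqOn f g Ω) : IsJet Ω p g D :=
  ⟨h.1.trans hfg, h.2⟩

theorem add (h : IsJet Ω p f D) (h' : IsJet Ω p g E) : IsJet Ω p (f + g) (D + E) :=
  ⟨fun _ hz => congrArg₂ (· + ·) (h.1 hz) (h'.1 hz),
    fun γ α hγ => (h.2.1 γ α hγ).add (h'.2.1 γ α hγ),
    fun γ α hγ z hz => (h.2.2.1 γ α hγ z hz).add (h'.2.2.1 γ α hγ z hz),
    fun γ α hγ i z hz => (h.2.2.2 γ α hγ i z hz).add (h'.2.2.2 γ α hγ i z hz)⟩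

theorem sub (h : IsJet Ω p f D) (h' : IsJet Ω p g E) : IsJet Ω p (f - g) (D - E) :=
  ⟨fun _ hz => congrArg₂ (· - ·) (h.1 hz) (h'.1 hz),
    fun γ α hγ => (h.2.1 γ α hγ).sub (h'.2.1 γ α hγ),
    fun γ α hγ z hz => (h.2.2.1 γ α hγ z hz).sub (h'.2.2.1 γ α hγ z hz),
    fun γ α hγ i z hz => (h.2.2.2 γ α hγ i z hz).sub (h'.2.2.2 γ α hγ i z hz)⟩

theorem const (c : Fin m → ℝ) :
    IsJet Ω p (fun _ => c) (fun β _ => if β = 0 then c else 0) := by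
  refine ⟨fun _ _ => if_pos rfl, fun _ _ _ => continuousOn_const, fun γ α _ z _ => ?_,
    fun γ α _ i z _ => ?_⟩
  · beta_reduce
    rw [if_neg (c := (γ + 1, α) = 0) (by simp [Prod.ext_iff])]
    exact hasDerivAt_const _ _
  · beta_reduce
    rw [if_neg (c := (γ, α + Pi.single i 1) = 0)]
    · exact hasDerivAt_const _ _
    · intro h
      have := congrFun (congrArg Prod.snd h) i
      simp at this

theorem sepRegular (h : IsJet Ω p f D) : SepRegular Ω p f := ⟨D, h⟩

/-- A function of class `C_t^p C_x^∞` has its own derivatives as a jet. -/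
theorem isJet_derivOn (h : IsJet Ω p f D) (hΩ : Ω ⊆ closure (interior Ω)) :
    IsJet Ω p f (fun β => derivOn Ω β f) := by
  have e : ∀ γ α, γ ≤ p → EqOn (derivOn Ω (γ, α) f) (D (γ, α)) Ω :=
    fun γ α hγ => h.derivOn_eq hΩ (β := (γ, α)) hγ
  refine ⟨(e 0 0 (Nat.zero_le p)).trans h.1, fun γ α hγ => (h.2.1 γ α hγ).congr (e γ α hγ),
    fun γ α hγ z hz => ?_, fun γ α hγ i z hz => ?_⟩
  · simp only [e (γ + 1) α hγ (interior_subset hz)]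
    refine (h.2.2.1 γ α hγ z hz).congr_of_eventuallyEq ?_
    filter_upwards [(tendsto_lineT z).eventually (isOpen_interior.mem_nhds hz)] with τ hτ
      using e γ α hγ.le (interior_subset hτ)
  · simp only [e γ (α + Pi.single i 1) hγ (interior_subset hz)]
    refine (h.2.2.2 γ α hγ i z hz).congr_of_eventuallyEq ?_
    filter_upwards [(tendsto_lineX i z).eventually (isOpen_interior.mem_nhds hz)] with τ hτ
      using e γ α hγ (interior_subset hτ)

end IsJet

theorem SepRegular.isJet (h : SepRegular Ω p f) (hΩ : Ω ⊆ closure (interior Ω)) :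
    IsJet Ω p f (fun β => derivOn Ω β f) := by
  obtain ⟨D, hD⟩ := sepRegular_iff.1 h
  exact hD.isJet_derivOn hΩ

theorem SepRegular.sub (h : SepRegular Ω p f) (h' : SepRegular Ω p g) :
    SepRegular Ω p (f - g) := by
  obtain ⟨D, hD⟩ := sepRegular_iff.1 h
  obtain ⟨E, hE⟩ := sepRegular_iff.1 h'
  exact (hD.sub hE).sepRegular

theorem derivOn_sub (h : SepRegular Ω p f) (h' : SepRegular Ω p g)
    (hΩ : Ω ⊆ closure (interior Ω)) {β : ℕ × (Fin s → ℕ)} (hβ : β.1 ≤ p) {z : ℝ × (Fin s → ℝ)}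
    (hz : z ∈ Ω) : derivOn Ω β (f - g) z = derivOn Ω β f z - derivOn Ω β g z := by
  exact ((h.isJet hΩ).sub (h'.isJet hΩ)).derivOn_eq hΩ hβ hz

/-- The derivatives on `Ω` depend only on the values on `Ω`. -/
theorem derivOn_congr (hfg : EqOn f g Ω) (β : ℕ × (Fin s → ℕ)) :
    EqOn (derivOn Ω β f) (derivOn Ω β g) Ω := by
  have hT : ∀ n, EqOn (partialT^[n] f) (partialT^[n] g) (interior Ω) := by
    intro n
    induction n with
    | zero => exact hfg.mono interior_subset
    | succ n ih =>
      simp only [Function.iterate_succ_apply']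
      exact eqOn_partialT isOpen_interior ih
  have hX : ∀ (i : Fin s) (n : ℕ) (u v : ℝ × (Fin s → ℝ) → (Fin m → ℝ)),
      EqOn u v (interior Ω) → EqOn ((partialX i)^[n] u) ((partialX i)^[n] v) (interior Ω) := by
    intro i n u v huv
    induction n with
    | zero => exact huv
    | succ n ih =>
      simp only [Function.iterate_succ_apply']
      exact eqOn_partialX isOpen_interior i ih
  have key : EqOn (partialDeriv β f) (partialDeriv β g) (interior Ω) := by
    unfold partialDeriv
    generalize List.finRange s = l
    induction l with
    | nil => exact hT _
    | cons i l ih => exact hX i _ _ _ ih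
  intro z _
  have : map (partialDeriv β f) (𝓝[interior Ω] z) = map (partialDeriv β g) (𝓝[interior Ω] z) :=
    map_congr (key.eventuallyEq_of_mem self_mem_nhdsWithin)
  simp only [derivOn, extendFrom, limUnder, this]

end Jets

/-! ### The cylinder `T × S` -/

section Cylinder

variable {s : ℕ} {t₀ a b : ℝ} {S : Set (Fin s → ℝ)} {z : ℝ × (Fin s → ℝ)} {σ : ℝ}

theorem interior_cylinder : interior (cylinder t₀ a b S) =
    Ioo (t₀ - a) (t₀ + b) ×ˢ interior S := by
  rw [cylinder, interior_prod_eq, interior_Icc]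

theorem cylinder_subset_closure_interior (ha : 0 < a) (hb : 0 < b)
    (hS : S ⊆ closure (interior S)) :
    cylinder t₀ a b S ⊆ closure (interior (cylinder t₀ a b S)) := by
  rw [interior_cylinder, closure_prod_eq, closure_Ioo (by linarith)]
  exact prod_mono_right hS

theorem isCompact_cylinder (hS : IsCompact S) : IsCompact (cylinder t₀ a b S) :=
  isCompact_Icc.prod hS

theorem mk_mem_cylinder (ha : 0 < a) (hb : 0 < b) (hz : z ∈ cylinder t₀ a b S)
    (hσ : σ ∈ uIcc t₀ z.1) : (σ, z.2) ∈ cylinder t₀ a b S :=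
  ⟨uIcc_subset_Icc ⟨by linarith, by linarith⟩ hz.1 hσ, hz.2⟩

theorem mk_mem_interior_cylinder (ha : 0 < a) (hb : 0 < b)
    (hz : z ∈ interior (cylinder t₀ a b S)) (hσ : σ ∈ uIcc t₀ z.1) :
    (σ, z.2) ∈ interior (cylinder t₀ a b S) := by
  rw [interior_cylinder] at hz ⊢
  exact ⟨ordConnected_Ioo.uIcc_subset ⟨by linarith, by linarith⟩ hz.1 hσ, hz.2⟩

end Cylinder

/-! ### Iterated integrals in `t` -/

/-- The `j`-fold integral `I_j[g](t, x)` as a function of both variables. -/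
noncomputable def iterIntT {s : ℕ} {E : Type*} [NormedAddCommGroup E] [NormedSpace ℝ E] (t₀ : ℝ)
    (j : ℕ) (g : ℝ × (Fin s → ℝ) → E) : ℝ × (Fin s → ℝ) → E :=
  fun z => iterInt t₀ j (fun σ => g (σ, z.2)) z.1

section IterInt

variable {s : ℕ} {t₀ a b : ℝ} {S : Set (Fin s → ℝ)} {E : Type*} [NormedAddCommGroup E]
  [NormedSpace ℝ E] {g h : ℝ × (Fin s → ℝ) → E} {z : ℝ × (Fin s → ℝ)}

@[simp]
theorem iterIntT_zero : iterIntT t₀ 0 g = g := rfl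

theorem iterIntT_succ (j : ℕ) (z : ℝ × (Fin s → ℝ)) :
    iterIntT t₀ (j + 1) g z = ∫ σ in t₀..z.1, iterIntT t₀ j g (σ, z.2) := rfl

theorem iterIntT_succ_initial (j : ℕ) (x : Fin s → ℝ) : iterIntT t₀ (j + 1) g (t₀, x) = 0 := by
  simp [iterIntT_succ]

theorem continuousOn_section {E : Type*} [TopologicalSpace E] {g : ℝ × (Fin s → ℝ) → E}
    (ha : 0 < a) (hb : 0 < b)
    (hg : ContinuousOn g (cylinder t₀ a b S)) (hz : z ∈ cylinder t₀ a b S) :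
    ContinuousOn (fun σ => g (σ, z.2)) (uIcc t₀ z.1) :=
  hg.comp (by fun_prop) fun _ hσ => mk_mem_cylinder ha hb hz hσ

theorem intervalIntegrable_section {E : Type*} [NormedAddCommGroup E]
    {g : ℝ × (Fin s → ℝ) → E} (ha : 0 < a) (hb : 0 < b)
    (hg : ContinuousOn g (cylinder t₀ a b S)) (hz : z ∈ cylinder t₀ a b S) :
    IntervalIntegrable (fun σ => g (σ, z.2)) MeasureTheory.volume t₀ z.1 :=
  (continuousOn_section ha hb hg hz).intervalIntegrable

theorem continuousOn_integral (ha : 0 < a) (hb : 0 < b)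
    (hg : ContinuousOn g (cylinder t₀ a b S)) :
    ContinuousOn (fun z => ∫ σ in t₀..z.1, g (σ, z.2)) (cylinder t₀ a b S) := by
  have hab : t₀ - a ≤ t₀ + b := by linarith
  -- The integrand is extended from `T` to all times by clamping.
  let f : S → ℝ → E := fun x σ => g (projIcc (t₀ - a) (t₀ + b) hab σ, x)
  have hf : Continuous f.uncurry := by
    have hm : Continuous fun w : S × ℝ =>
        (((projIcc (t₀ - a) (t₀ + b) hab w.2 : ℝ), (w.1 : Fin s → ℝ)) : ℝ × (Fin s → ℝ)) := by
      fun_prop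
    exact hg.comp_continuous hm fun w => ⟨(projIcc _ _ hab w.2).2, w.1.2⟩
  have hc : Continuous fun w : S × ℝ => ∫ σ in t₀..w.2, f w.1 σ :=
    intervalIntegral.continuous_parametric_primitive_of_continuous hf
  rw [continuousOn_iff_continuous_domRestrict]
  have hm : Continuous fun w : cylinder t₀ a b S => ((⟨w.1.2, w.2.2⟩ : S), w.1.1) := by
    fun_prop
  refine (hc.comp hm).congr fun w => ?_
  refine intervalIntegral.integral_congr fun σ hσ => ?_
  have := (mk_mem_cylinder ha hb w.2 hσ).1
  simp only [projIcc_of_mem hab this]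

theorem continuousOn_iterIntT (ha : 0 < a) (hb : 0 < b)
    (hg : ContinuousOn g (cylinder t₀ a b S)) (j : ℕ) :
    ContinuousOn (iterIntT t₀ j g) (cylinder t₀ a b S) := by
  induction j with
  | zero => exact hg
  | succ j ih => exact continuousOn_integral ha hb ih

theorem hasDerivAt_integral_time [CompleteSpace E] (ha : 0 < a) (hb : 0 < b)
    (hg : ContinuousOn g (cylinder t₀ a b S)) (hz : z ∈ interior (cylinder t₀ a b S)) :
    HasDerivAt (fun τ => ∫ σ in t₀..τ, g (σ, z.2)) (g z) z.1 := by
  have hU : IsOpen {τ : ℝ | (τ, z.2) ∈ interior (cylinder t₀ a b S)} :=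
    isOpen_interior.preimage (Continuous.prodMk_left z.2)
  have hc : ContinuousOn (fun σ => g (σ, z.2))
      {τ : ℝ | (τ, z.2) ∈ interior (cylinder t₀ a b S)} :=
    hg.comp (by fun_prop) fun _ hσ => interior_subset hσ
  exact intervalIntegral.integral_hasDerivAt_right
    (intervalIntegrable_section ha hb hg (interior_subset hz))
    (hc.stronglyMeasurableAtFilter hU _ hz) (hc.continuousAt (hU.mem_nhds hz))

theorem hasDerivAt_integral_space (ha : 0 < a) (hb : 0 < b) (hS : IsCompact S) {i : Fin s}
    (hg : ContinuousOn g (cylinder t₀ a b S)) (hh : ContinuousOn h (cylinder t₀ a b S))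
    (hd : ∀ z ∈ interior (cylinder t₀ a b S),
      HasDerivAt (fun ξ => g (z.1, Function.update z.2 i ξ)) (h z) (z.2 i))
    (hz : z ∈ interior (cylinder t₀ a b S)) :
    HasDerivAt (fun ξ => ∫ σ in t₀..z.1, g (σ, Function.update z.2 i ξ))
      (∫ σ in t₀..z.1, h (σ, z.2)) (z.2 i) := by
  obtain ⟨C, hC⟩ := (isCompact_cylinder hS).exists_bound_of_continuousOn hh
  have hs : {ξ : ℝ | (z.1, Function.update z.2 i ξ) ∈ interior (cylinder t₀ a b S)} ∈ 𝓝 (z.2 i) :=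
    (tendsto_lineX i z).eventually (isOpen_interior.mem_nhds hz)
  have key := (intervalIntegral.hasDerivAt_integral_of_dominated_loc_of_deriv_le
    (μ := MeasureTheory.volume) (a := t₀) (b := z.1)
    (F := fun ξ σ => g (σ, Function.update z.2 i ξ))
    (F' := fun ξ σ => h (σ, Function.update z.2 i ξ)) (x₀ := z.2 i) (bound := fun _ => C)
    hs ?_ ?_ ?_ ?_ ?_ ?_).2
  · simpa using key
  · filter_upwards [hs] with ξ hξ
    exact (intervalIntegrable_section ha hb hg (interior_subset hξ)).def'.aestronglyMeasurable
  · simpa using intervalIntegrable_section ha hb hg (interior_subset hz)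
  · simpa using
      (intervalIntegrable_section ha hb hh (interior_subset hz)).def'.aestronglyMeasurable
  · refine Eventually.of_forall fun σ hσ ξ hξ => hC _ ?_
    exact mk_mem_cylinder ha hb (z := (z.1, Function.update z.2 i ξ)) (interior_subset hξ)
      (uIoc_subset_uIcc hσ)
  · exact intervalIntegrable_const
  · refine Eventually.of_forall fun σ hσ ξ hξ => ?_
    have := hd _ (mk_mem_interior_cylinder ha hb (z := (z.1, Function.update z.2 i ξ)) hξ
      (uIoc_subset_uIcc hσ))
    simpa using this

theorem hasDerivAt_iterIntT_space (ha : 0 < a) (hb : 0 < b) (hS : IsCompact S) {i : Fin s}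
    (hg : ContinuousOn g (cylinder t₀ a b S)) (hh : ContinuousOn h (cylinder t₀ a b S))
    (hd : ∀ z ∈ interior (cylinder t₀ a b S),
      HasDerivAt (fun ξ => g (z.1, Function.update z.2 i ξ)) (h z) (z.2 i)) (j : ℕ) :
    ∀ z ∈ interior (cylinder t₀ a b S),
      HasDerivAt (fun ξ => iterIntT t₀ j g (z.1, Function.update z.2 i ξ))
        (iterIntT t₀ j h z) (z.2 i) := by
  induction j with
  | zero => exact hd
  | succ j ih =>
    intro z hz
    exact hasDerivAt_integral_space ha hb hS (continuousOn_iterIntT ha hb hg j)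
      (continuousOn_iterIntT ha hb hh j) ih hz

theorem iterIntT_mul_const (j : ℕ) (φ : ℝ × (Fin s → ℝ) → ℝ) (c : ℝ) (z : ℝ × (Fin s → ℝ)) :
    iterIntT t₀ j (fun w => φ w * c) z = iterIntT t₀ j φ z * c := by
  induction j generalizing z with
  | zero => rfl
  | succ j ih => simp only [iterIntT_succ, ih, intervalIntegral.integral_mul_const]

theorem iterIntT_sub (ha : 0 < a) (hb : 0 < b) (hg : ContinuousOn g (cylinder t₀ a b S))
    (hh : ContinuousOn h (cylinder t₀ a b S)) (j : ℕ) (hz : z ∈ cylinder t₀ a b S) :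
    iterIntT t₀ j (g - h) z = iterIntT t₀ j g z - iterIntT t₀ j h z := by
  induction j generalizing z with
  | zero => rfl
  | succ j ih =>
    simp only [iterIntT_succ]
    rw [← intervalIntegral.integral_sub
      (intervalIntegrable_section ha hb (continuousOn_iterIntT ha hb hg j) hz)
      (intervalIntegrable_section ha hb (continuousOn_iterIntT ha hb hh j) hz)]
    exact intervalIntegral.integral_congr fun σ hσ => ih (mk_mem_cylinder ha hb hz hσ)

/-- If `‖g‖ ≤ φ`, then `‖I_j[g]‖ ≤ e ^ j I_j[φ]`, where `e` is the sign of `t - t₀`: for `t < t₀`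
each integration of a function of constant sign reverses the sign. -/
theorem norm_iterIntT_le_sign_mul (ha : 0 < a) (hb : 0 < b) {φ : ℝ × (Fin s → ℝ) → ℝ}
    (hφ : ContinuousOn φ (cylinder t₀ a b S))
    (hle : ∀ z ∈ cylinder t₀ a b S, ‖g z‖ ≤ φ z) {e : ℝ} (he : e = 1 ∨ e = -1) (j : ℕ)
    (hz : z ∈ cylinder t₀ a b S) (hez : 0 ≤ e * (z.1 - t₀)) :
    ‖iterIntT t₀ j g z‖ ≤ e ^ j * iterIntT t₀ j φ z := by
  induction j generalizing z with
  | zero => simpa using hle z hz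
  | succ j ih =>
    have hint := (intervalIntegrable_section ha hb (continuousOn_iterIntT ha hb hφ j) hz).const_mul
      (e ^ j)
    simp only [iterIntT_succ]
    rw [pow_succ', mul_assoc, ← intervalIntegral.integral_const_mul]
    rcases he with rfl | rfl
    · have h0 : t₀ ≤ z.1 := by linarith
      rw [one_mul]
      refine intervalIntegral.norm_integral_le_of_norm_le h0 (Eventually.of_forall fun σ hσ => ?_)
        hint
      exact ih (z := (σ, z.2)) (mk_mem_cylinder ha hb hz (by
        rw [uIcc_of_le h0]; exact Ioc_subset_Icc_self hσ)) (by simpa using hσ.1.le)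
    · have h0 : z.1 ≤ t₀ := by linarith
      rw [neg_one_mul, ← intervalIntegral.integral_symm, intervalIntegral.integral_symm, norm_neg]
      refine intervalIntegral.norm_integral_le_of_norm_le h0 (Eventually.of_forall fun σ hσ => ?_)
        hint.symm
      exact ih (z := (σ, z.2)) (mk_mem_cylinder ha hb hz (by
        rw [uIcc_of_ge h0]; exact Ioc_subset_Icc_self hσ)) (by simpa using hσ.2)

theorem norm_iterIntT_le (ha : 0 < a) (hb : 0 < b) {φ : ℝ × (Fin s → ℝ) → ℝ}
    (hφ : ContinuousOn φ (cylinder t₀ a b S))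
    (hle : ∀ z ∈ cylinder t₀ a b S, ‖g z‖ ≤ φ z) (j : ℕ)
    (hz : z ∈ cylinder t₀ a b S) :
    ‖iterIntT t₀ j g z‖ ≤ |iterIntT t₀ j φ z| := by
  obtain ⟨e, he, hez⟩ : ∃ e : ℝ, (e = 1 ∨ e = -1) ∧ 0 ≤ e * (z.1 - t₀) := by
    rcases le_total t₀ z.1 with h | h
    · exact ⟨1, Or.inl rfl, by linarith⟩
    · exact ⟨-1, Or.inr rfl, by linarith⟩
  refine (norm_iterIntT_le_sign_mul ha hb hφ hle he j hz hez).trans ((le_abs_self _).trans ?_)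
  rw [abs_mul, abs_pow]
  rcases he with rfl | rfl <;> simp

end IterInt

section IntegralJet

variable {s m : ℕ} {t₀ a b : ℝ} {S : Set (Fin s → ℝ)}
  {g : ℝ × (Fin s → ℝ) → (Fin m → ℝ)} {D : ℕ × (Fin s → ℕ) → ℝ × (Fin s → ℝ) → (Fin m → ℝ)}

/-- `∂_x^α ∂_t^γ I_d[g] = I_{d-γ}[∂_x^α g]` for `γ ≤ d`. -/
theorem IsJet.iterIntT (ha : 0 < a) (hb : 0 < b) (hS : IsCompact S)
    (h : IsJet (cylinder t₀ a b S) 0 g D) (d : ℕ) :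
    IsJet (cylinder t₀ a b S) d (iterIntT t₀ d g) fun β => iterIntT t₀ (d - β.1) (D (0, β.2)) := by
  refine ⟨fun z hz => ?_, fun γ α _ => ?_, fun γ α hγ z hz => ?_, fun γ α hγ i => ?_⟩
  · have : ∀ j, ∀ z ∈ cylinder t₀ a b S,
        _root_.iterIntT t₀ j (D 0) z = _root_.iterIntT t₀ j g z := by
      intro j
      induction j with
      | zero => exact h.1
      | succ j ih =>
        intro z hz
        exact intervalIntegral.integral_congr fun σ hσ => ih _ (mk_mem_cylinder ha hb hz hσ)
    exact this d z hz
  · exact continuousOn_iterIntT ha hb (h.2.1 0 α le_rfl) _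
  · obtain ⟨n, hn⟩ : ∃ n, d - γ = n + 1 := ⟨d - γ - 1, by lia⟩
    have hn' : d - (γ + 1) = n := by lia
    simp only [hn, hn', iterIntT_succ]
    exact hasDerivAt_integral_time ha hb (continuousOn_iterIntT ha hb (h.2.1 0 α le_rfl) n) hz
  · exact hasDerivAt_iterIntT_space ha hb hS (h.2.1 0 α le_rfl) (h.2.1 0 _ le_rfl)
      (h.2.2.2 0 α le_rfl i) _

end IntegralJet

/-! ### Functions of class `C^n` up to the boundary -/

universe u

/-- `f ∈ C^n(Ω)`: `f` is continuous on `Ω`, differentiable in the interior of `Ω`, and its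
derivative is there the restriction of a function of class `C^{n-1}(Ω)`. No differentiability is
required at the boundary points of `Ω`. -/
def CkUpTo {E : Type u} [NormedAddCommGroup E] [NormedSpace ℝ E] (Ω : Set E) :
    ℕ → {F : Type u} → [NormedAddCommGroup F] → [NormedSpace ℝ F] → (E → F) → Prop
  | 0, _, _, _, f => ContinuousOn f Ω
  | n + 1, F, _, _, f => ContinuousOn f Ω ∧ ∃ f' : E → E →L[ℝ] F,
      (∀ z ∈ interior Ω, HasFDerivAt f (f' z) z) ∧ CkUpTo Ω n f'

section Ck

variable {E F G H : Type u} [NormedAddCommGroup E] [NormedSpace ℝ E] [NormedAddCommGroup F]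
  [NormedSpace ℝ F] [NormedAddCommGroup G] [NormedSpace ℝ G] [NormedAddCommGroup H]
  [NormedSpace ℝ H] {Ω : Set E} {n : ℕ}

namespace CkUpTo

theorem continuousOn {f : E → F} (h : CkUpTo Ω n f) : ContinuousOn f Ω := by
  cases n with
  | zero => exact h
  | succ n => exact h.1

theorem of_succ {f : E → F} (h : CkUpTo Ω (n + 1) f) : CkUpTo Ω n f := by
  induction n generalizing F with
  | zero => exact h.1
  | succ n ih =>
    obtain ⟨hc, f', hf', h'⟩ := h
    exact ⟨hc, f', hf', ih h'⟩

theorem congr {f g : E → F} (h : CkUpTo Ω n f) (hfg : EqOn f g Ω) : CkUpTo Ω n g := by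
  cases n with
  | zero => exact ContinuousOn.congr h hfg.symm
  | succ n =>
    obtain ⟨hc, f', hf', h'⟩ := h
    refine ⟨hc.congr hfg.symm, f', fun z hz => (hf' z hz).congr_of_eventuallyEq ?_, h'⟩
    filter_upwards [isOpen_interior.mem_nhds hz] with w hw using (hfg (interior_subset hw)).symm

theorem of_contDiff {f : E → F} (h : ContDiff ℝ n f) : CkUpTo Ω n f := by
  induction n generalizing F with
  | zero => exact h.continuous.continuousOn
  | succ n ih =>
    have h1 : ((n + 1 : ℕ) : WithTop ℕ∞) ≠ 0 := by simp
    refine ⟨h.continuous.continuousOn, fderiv ℝ f,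
      fun z _ => (h.differentiable h1 z).hasFDerivAt, ih ?_⟩
    exact h.fderiv_right (by norm_cast)

theorem clm_comp {f : E → F} (A : F →L[ℝ] G) (h : CkUpTo Ω n f) :
    CkUpTo Ω n fun z => A (f z) := by
  induction n generalizing F G with
  | zero => exact A.continuous.comp_continuousOn h
  | succ n ih =>
    obtain ⟨hc, f', hf', h'⟩ := h
    exact ⟨A.continuous.comp_continuousOn hc, _,
      fun z hz => A.hasFDerivAt.comp z (hf' z hz), ih (ContinuousLinearMap.compL ℝ E F G A) h'⟩

theorem add {f g : E → F} (hf : CkUpTo Ω n f) (hg : CkUpTo Ω n g) :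
    CkUpTo Ω n fun z => f z + g z := by
  induction n generalizing F with
  | zero => exact ContinuousOn.add hf hg
  | succ n ih =>
    obtain ⟨hc, f', hf', h'⟩ := hf
    obtain ⟨kc, g', hg', k'⟩ := hg
    exact ⟨hc.add kc, _, fun z hz => (hf' z hz).add (hg' z hz), ih h' k'⟩

theorem sum {ι : Type*} (t : Finset ι) {f : ι → E → F} (hf : ∀ i, CkUpTo Ω n (f i)) :
    CkUpTo Ω n fun z => ∑ i ∈ t, f i z := by
  classical
  induction t using Finset.induction_on with
  | empty => exact of_contDiff (by simpa using contDiff_const)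
  | insert i t hi ih =>
    simp only [Finset.sum_insert hi]
    exact (hf i).add ih

theorem bilinear (B : F →L[ℝ] G →L[ℝ] H) {f : E → F} {g : E → G} (hf : CkUpTo Ω n f)
    (hg : CkUpTo Ω n g) : CkUpTo Ω n fun z => B (f z) (g z) := by
  have hcont : ContinuousOn (fun z => B (f z) (g z)) Ω :=
    (B.continuous.comp_continuousOn hf.continuousOn).clm_apply hg.continuousOn
  induction n generalizing F G H with
  | zero => exact hcont
  | succ n ih =>
    have hf0 := hf.of_succ
    have hg0 := hg.of_succ
    obtain ⟨hc, f', hf', h'⟩ := hf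
    obtain ⟨kc, g', hg', k'⟩ := hg
    refine ⟨hcont, _, fun z hz => B.hasFDerivAt_of_bilinear (hf' z hz) (hg' z hz), ?_⟩
    refine add (ih (B.precompR E) hf0 k' ?_) (ih (B.precompL E) h' hg0 ?_)
    · exact ((B.precompR E).continuous.comp_continuousOn hc).clm_apply k'.continuousOn
    · exact ((B.precompL E).continuous.comp_continuousOn h'.continuousOn).clm_apply kc

theorem prodMk {f : E → F} {g : E → G} (hf : CkUpTo Ω n f) (hg : CkUpTo Ω n g) :
    CkUpTo Ω n fun z => (f z, g z) := by
  refine (add (hf.clm_comp (ContinuousLinearMap.inl ℝ F G))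
    (hg.clm_comp (ContinuousLinearMap.inr ℝ F G))).congr fun z _ => ?_
  simp

theorem pi {ι : Type u} [Fintype ι] {f : ι → E → F} (hf : ∀ i, CkUpTo Ω n (f i)) :
    CkUpTo Ω n fun z i => f i z := by
  classical
  refine (sum (Finset.univ : Finset ι) fun i =>
    (hf i).clm_comp (ContinuousLinearMap.single ℝ (fun _ : ι => F) i)).congr fun z _ => ?_
  ext i
  simp [Finset.sum_apply, Pi.single_apply]

theorem comp {Ω' : Set F} {f : F → G} {φ : E → F} (hf : CkUpTo Ω' n f) (hφ : CkUpTo Ω n φ)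
    (hm : MapsTo φ Ω Ω') (hi : MapsTo φ (interior Ω) (interior Ω')) :
    CkUpTo Ω n fun z => f (φ z) := by
  have hcont : ContinuousOn (fun z => f (φ z)) Ω := hf.continuousOn.comp hφ.continuousOn hm
  induction n generalizing G with
  | zero => exact hcont
  | succ n ih =>
    have hφ0 := hφ.of_succ
    obtain ⟨hc, f', hf', h'⟩ := hf
    obtain ⟨kc, φ', hφ', k'⟩ := hφ
    refine ⟨hcont, _, fun z hz => (hf' _ (hi hz)).comp z (hφ' z hz), ?_⟩
    exact bilinear (ContinuousLinearMap.compL ℝ E F G)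
      (ih h' hφ0 (h'.continuousOn.comp hφ0.continuousOn hm)) k'

theorem contDiffOn {f : E → F} (h : CkUpTo Ω n f) : ContDiffOn ℝ n f (interior Ω) := by
  induction n generalizing F with
  | zero => exact contDiffOn_zero.2 (h.continuousOn.mono interior_subset)
  | succ n ih =>
    obtain ⟨hc, f', hf', h'⟩ := h
    have : ((n + 1 : ℕ) : WithTop ℕ∞) = (n : WithTop ℕ∞) + 1 := by norm_cast
    rw [this, contDiffOn_succ_iff_fderiv_of_isOpen isOpen_interior]
    refine ⟨fun z hz => (hf' z hz).differentiableAt.differentiableWithinAt, by simp, ?_⟩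
    exact (ih h').congr fun z hz => (hf' z hz).fderiv

theorem exists_extension {f : E → F} (h : CkUpTo Ω n f) :
    ∃ g : E → ContinuousMultilinearMap ℝ (fun _ : Fin n => E) F,
      ContinuousOn g Ω ∧ EqOn g (iteratedFDeriv ℝ n f) (interior Ω) := by
  induction n generalizing F with
  | zero =>
    exact ⟨fun z => (continuousMultilinearCurryFin0 ℝ E F).symm (f z),
      (LinearIsometryEquiv.continuous _).comp_continuousOn h.continuousOn,
      fun z _ => by rw [iteratedFDeriv_zero_eq_comp]; rfl⟩
  | succ n ih =>
    obtain ⟨hc, f', hf', h'⟩ := h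
    obtain ⟨g, hg, hgf⟩ := ih h'
    refine ⟨fun z => (continuousMultilinearCurryRightEquiv' ℝ n E F).symm (g z),
      (LinearIsometryEquiv.continuous _).comp_continuousOn hg, fun z hz => ?_⟩
    rw [iteratedFDeriv_succ_eq_comp_right, Function.comp_apply]
    beta_reduce
    rw [hgf hz]
    congr 1
    have : f' =ᶠ[𝓝 z] fun y => fderiv ℝ f y := by
      filter_upwards [isOpen_interior.mem_nhds hz] with w hw using (hf' w hw).fderiv.symm
    exact (this.iteratedFDeriv ℝ n).eq_of_nhds

end CkUpTo

theorem smoothUpTo_of_forall_ckUpTo {f : E → F} (h : ∀ n, CkUpTo Ω n f) : SmoothUpTo Ω f :=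
  ⟨(h 0).continuousOn, contDiffOn_infty.2 fun n => (h n).contDiffOn,
    fun n => (h n).exists_extension⟩

/-- The derivative of a function in `C^∞(Ω)`, continued to `Ω`, belongs to `C^∞(Ω)`. -/
theorem SmoothUpTo.exists_fderiv {f : E → F} (h : SmoothUpTo Ω f) :
    ∃ f' : E → E →L[ℝ] F, (∀ z ∈ interior Ω, HasFDerivAt f (f' z) z) ∧ SmoothUpTo Ω f' := by
  obtain ⟨hc, hd, he⟩ := h
  choose g hg hgf using he
  have hfd : ∀ z ∈ interior Ω, HasFDerivAt f (fderiv ℝ f z) z := fun z hz =>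
    ((hd.differentiableOn (by simp)).differentiableAt (isOpen_interior.mem_nhds hz)).hasFDerivAt
  have hcurry : ∀ n, ∀ z ∈ interior Ω,
      continuousMultilinearCurryRightEquiv' ℝ n E F (g (n + 1) z) =
        iteratedFDeriv ℝ n (fun y => fderiv ℝ f y) z := by
    intro n z hz
    rw [hgf (n + 1) hz, iteratedFDeriv_succ_eq_comp_right]
    simp
  let f' : E → E →L[ℝ] F := fun z =>
    continuousMultilinearCurryFin0 ℝ E (E →L[ℝ] F)
      (continuousMultilinearCurryRightEquiv' ℝ 0 E F (g 1 z))
  have hf' : EqOn f' (fderiv ℝ f) (interior Ω) := by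
    intro z hz
    simp only [f']
    rw [hcurry 0 z hz, iteratedFDeriv_zero_eq_comp]
    simp
  refine ⟨f', fun z hz => hf' hz ▸ hfd z hz, ?_, ?_, fun n => ?_⟩
  · exact (LinearIsometryEquiv.continuous _).comp_continuousOn
      ((LinearIsometryEquiv.continuous _).comp_continuousOn (hg 1))
  · exact (hd.fderiv_of_isOpen isOpen_interior (by simp)).congr hf'
  · refine ⟨fun z => continuousMultilinearCurryRightEquiv' ℝ n E F (g (n + 1) z),
      (LinearIsometryEquiv.continuous _).comp_continuousOn (hg (n + 1)), fun z hz => ?_⟩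
    beta_reduce
    rw [hcurry n z hz]
    have : (fun y => fderiv ℝ f y) =ᶠ[𝓝 z] f' := by
      filter_upwards [isOpen_interior.mem_nhds hz] with w hw using (hf' hw).symm
    exact (this.iteratedFDeriv ℝ n).eq_of_nhds

theorem SmoothUpTo.ckUpTo {f : E → F} (h : SmoothUpTo Ω f) (n : ℕ) : CkUpTo Ω n f := by
  induction n generalizing F with
  | zero => exact h.1
  | succ n ih =>
    obtain ⟨f', hf', h'⟩ := h.exists_fderiv
    exact ⟨h.1, f', hf', ih h'⟩

end Ck

/-! ### Continuous partial derivatives and `C^n` functions -/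

section Partials

/-- A function on `ℝ^ι` with partial derivatives on an open set, continuous there, is
differentiable: the increment is split into increments along the coordinate axes. -/
theorem hasFDerivAt_of_continuousOn_partials {ι F : Type*} [Fintype ι] [DecidableEq ι]
    [NormedAddCommGroup F] [NormedSpace ℝ F] {f : (ι → ℝ) → F} {g : ι → (ι → ℝ) → F}
    {U : Set (ι → ℝ)} (hU : IsOpen U)
    (hd : ∀ i, ∀ z ∈ U, HasDerivAt (fun ξ => f (Function.update z i ξ)) (g i z) (z i))
    (hg : ∀ i, ContinuousOn (g i) U) {z : ι → ℝ} (hz : z ∈ U) :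
    HasFDerivAt f (∑ i, (ContinuousLinearMap.proj (R := ℝ) (φ := fun _ : ι => ℝ) i).smulRight
      (g i z)) z := by
  rw [hasFDerivAt_iff_isLittleO, Asymptotics.isLittleO_iff]
  intro c hc
  set ε : ℝ := c / (Fintype.card ι + 1) with hε
  have hεpos : 0 < ε := by positivity
  have hnear : ∀ᶠ w in 𝓝 z, w ∈ U ∧ ∀ i, ‖g i w - g i z‖ ≤ ε := by
    refine (hU.eventually_mem hz).and (eventually_all.2 fun i => ?_)
    filter_upwards [Metric.tendsto_nhds.1 ((hg i).continuousAt (hU.mem_nhds hz)) ε hεpos] with w hw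
    rw [dist_eq_norm] at hw
    exact hw.le
  obtain ⟨δ, hδ, hball⟩ := Metric.eventually_nhds_iff_ball.1 hnear
  filter_upwards [Metric.ball_mem_nhds z hδ] with w hw
  have hw' : ∀ i, w i ∈ Metric.ball (z i) δ := fun i =>
    (dist_le_pi_dist w z i).trans_lt hw
  have key : ∀ A : Finset ι, ‖f (A.piecewise w z) - f z - ∑ i ∈ A, (w i - z i) • g i z‖
      ≤ A.card * (ε * ‖w - z‖) := by
    intro A
    induction A using Finset.induction_on with
    | empty => simp
    | insert j A hj ih =>
      have hvj : A.piecewise w z j = z j := Finset.piecewise_eq_of_notMem _ _ _ hj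
      rw [Finset.piecewise_insert, Finset.sum_insert hj, Finset.card_insert_of_notMem hj]
      set v := A.piecewise w z with hv
      have hmem : ∀ ξ ∈ Metric.ball (z j) δ, Function.update v j ξ ∈ Metric.ball z δ := by
        intro ξ hξ
        rw [Metric.mem_ball, dist_pi_lt_iff hδ]
        intro i
        by_cases hij : i = j
        · subst hij; simpa using hξ
        · rw [Function.update_of_ne hij]
          by_cases hiA : i ∈ A
          · rw [hv, Finset.piecewise_eq_of_mem _ _ _ hiA]; exact hw' i
          · rw [hv, Finset.piecewise_eq_of_notMem _ _ _ hiA]; simpa using hδ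
      have hstep : ‖(f (Function.update v j (w j)) - w j • g j z)
          - (f (Function.update v j (z j)) - z j • g j z)‖ ≤ ε * ‖w j - z j‖ := by
        refine Convex.norm_image_sub_le_of_norm_hasDerivWithin_le
          (f := fun ξ => f (Function.update v j ξ) - ξ • g j z)
          (f' := fun ξ => g j (Function.update v j ξ) - g j z)
          (fun ξ hξ => ?_) (fun ξ hξ => ?_) (convex_ball (z j) δ) (Metric.mem_ball_self hδ) (hw' j)
        · have h1 := hd j _ (hball _ (hmem ξ hξ)).1
          simp only [Function.update_idem, Function.update_self] at h1
          have h2 := (hasDerivAt_id ξ).smul_const (g j z)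
          rw [one_smul] at h2
          exact (h1.sub h2).hasDerivWithinAt
        · exact (hball _ (hmem ξ hξ)).2 j
      have hvz : Function.update v j (z j) = v := by rw [← hvj, Function.update_eq_self]
      rw [hvz] at hstep
      have hwz : ‖w j - z j‖ ≤ ‖w - z‖ := norm_le_pi_norm (w - z) j
      calc _ = ‖((f (Function.update v j (w j)) - w j • g j z) - (f v - z j • g j z))
            + (f v - f z - ∑ i ∈ A, (w i - z i) • g i z)‖ := by
              congr 1; rw [sub_smul]; abel
        _ ≤ ε * ‖w - z‖ + A.card * (ε * ‖w - z‖) :=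
          (norm_add_le _ _).trans (add_le_add (hstep.trans (by gcongr)) ih)
        _ = _ := by push_cast; ring
  have hfin := key Finset.univ
  simp only [Finset.piecewise_univ, Finset.card_univ] at hfin
  refine le_trans (le_of_eq ?_) (hfin.trans ?_)
  · congr 2
    simp
  · rw [← mul_assoc]
    gcongr
    rw [hε, mul_div_assoc', div_le_iff₀ (by positivity)]
    nlinarith

variable {s : ℕ} {F : Type} [NormedAddCommGroup F] [NormedSpace ℝ F]
  {Ω : Set (ℝ × (Fin s → ℝ))}

theorem hasFDerivAt_of_partialT_partialX {U : Set (ℝ × (Fin s → ℝ))} (hU : IsOpen U)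
    {f g : ℝ × (Fin s → ℝ) → F} {h : Fin s → ℝ × (Fin s → ℝ) → F}
    (hg : ContinuousOn g U) (hh : ∀ i, ContinuousOn (h i) U)
    (hT : ∀ z ∈ U, HasDerivAt (fun τ => f (τ, z.2)) (g z) z.1)
    (hX : ∀ i, ∀ z ∈ U, HasDerivAt (fun ξ => f (z.1, Function.update z.2 i ξ)) (h i z) (z.2 i))
    {z : ℝ × (Fin s → ℝ)} (hz : z ∈ U) :
    HasFDerivAt f ((ContinuousLinearMap.fst ℝ ℝ (Fin s → ℝ)).smulRight (g z) +
      ∑ i, ((ContinuousLinearMap.proj (R := ℝ) (φ := fun _ : Fin s => ℝ) i).comp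
        (ContinuousLinearMap.snd ℝ ℝ (Fin s → ℝ))).smulRight (h i z)) z := by
  have hUz := hU.mem_nhds hz
  have key := hasStrictFDerivAt_uncurry_coprod (𝕜 := ℝ) (u := z) (f := fun t x => f (t, x))
    (f₁ := fun t x => (ContinuousLinearMap.id ℝ ℝ).smulRight (g (t, x)))
    (f₂ := fun t x => ∑ i, (ContinuousLinearMap.proj (R := ℝ) (φ := fun _ : Fin s => ℝ) i).smulRight
      (h i (t, x))) ?_ ?_ ?_ ?_
  · refine key.hasFDerivAt.congr_fderiv ?_
    ext1
    · ext; simp [Function.HasUncurry.uncurry]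
    · ext v
      simp [Function.HasUncurry.uncurry]
  · filter_upwards [hUz] with v hv
    exact (hT v hv).hasFDerivAt
  · filter_upwards [hUz] with v hv
    exact hasFDerivAt_of_continuousOn_partials (f := fun x => f (v.1, x))
      (g := fun i x => h i (v.1, x)) (hU.preimage (Continuous.prodMk_right v.1))
      (fun i x hx => hX i (v.1, x) hx) (fun i => (hh i).comp (by fun_prop) fun x hx => hx) hv
  · have h1 : ContinuousAt g z := hg.continuousAt hUz
    exact ((ContinuousLinearMap.smulRightL ℝ ℝ F
      (ContinuousLinearMap.id ℝ ℝ)).continuous.continuousAt).comp h1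
  · have : ∀ i, ContinuousAt (h i) z := fun i => (hh i).continuousAt hUz
    suffices key : ContinuousAt (fun v : ℝ × (Fin s → ℝ) =>
        ∑ i, (ContinuousLinearMap.proj (R := ℝ) (φ := fun _ : Fin s => ℝ) i).smulRight (h i v))
        z from key
    refine tendsto_finsetSum _ fun i _ => ?_
    exact ((ContinuousLinearMap.smulRightL ℝ (Fin s → ℝ) F
      (ContinuousLinearMap.proj i)).continuous.continuousAt).comp (this i)

theorem CkUpTo.succ_of_partials {n : ℕ} {f g : ℝ × (Fin s → ℝ) → F}
    {h : Fin s → ℝ × (Fin s → ℝ) → F} (hf : ContinuousOn f Ω)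
    (hg : CkUpTo Ω n g) (hh : ∀ i, CkUpTo Ω n (h i))
    (hT : ∀ z ∈ interior Ω, HasDerivAt (fun τ => f (τ, z.2)) (g z) z.1)
    (hX : ∀ i, ∀ z ∈ interior Ω,
      HasDerivAt (fun ξ => f (z.1, Function.update z.2 i ξ)) (h i z) (z.2 i)) :
    CkUpTo Ω (n + 1) f := by
  refine ⟨hf, _, fun z hz => hasFDerivAt_of_partialT_partialX isOpen_interior
    (hg.continuousOn.mono interior_subset) (fun i => (hh i).continuousOn.mono interior_subset)
    hT hX hz, ?_⟩
  exact add (hg.clm_comp (ContinuousLinearMap.smulRightL ℝ (ℝ × (Fin s → ℝ)) F _))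
    (sum _ fun i => (hh i).clm_comp (ContinuousLinearMap.smulRightL ℝ (ℝ × (Fin s → ℝ)) F _))

end Partials

/-! ### The jet of a smooth function of `x` -/

section SpaceJet

variable {ι F : Type} [Fintype ι] [DecidableEq ι] [NormedAddCommGroup F] [NormedSpace ℝ F]

/-- The iterated partial derivative of `f` along the coordinates in the list `l`. -/
noncomputable def listDeriv (f : (ι → ℝ) → F) : List ι → (ι → ℝ) → F
  | [] => f
  | i :: l => fun x => fderiv ℝ (listDeriv f l) x (Pi.single i 1)

theorem contDiffOn_listDeriv {U : Set (ι → ℝ)} (hU : IsOpen U) {f : (ι → ℝ) → F}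
    (hf : ContDiffOn ℝ ∞ f U) (l : List ι) : ContDiffOn ℝ ∞ (listDeriv f l) U := by
  induction l with
  | nil => exact hf
  | cons i l ih => exact (ih.fderiv_of_isOpen hU (by simp)).clm_apply contDiffOn_const

theorem listDeriv_perm {U : Set (ι → ℝ)} (hU : IsOpen U) {f : (ι → ℝ) → F}
    (hf : ContDiffOn ℝ ∞ f U) {l l' : List ι} (h : l.Perm l') :
    EqOn (listDeriv f l) (listDeriv f l') U := by
  induction h with
  | nil => exact fun _ _ => rfl
  | cons i _ ih =>
    intro x hx
    have : listDeriv f _ =ᶠ[𝓝 x] listDeriv f _ := ih.eventuallyEq_of_mem (hU.mem_nhds hx)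
    simp only [listDeriv, this.fderiv_eq]
  | swap i j l =>
    intro x hx
    have hd : ContDiffAt ℝ ∞ (listDeriv f l) x :=
      (contDiffOn_listDeriv hU hf l).contDiffAt (hU.mem_nhds hx)
    have hd1 : DifferentiableAt ℝ (fderiv ℝ (listDeriv f l)) x :=
      (hd.fderiv_right (m := 1) (by norm_cast)).differentiableAt (by simp)
    have hs : IsSymmSndFDerivAt ℝ (listDeriv f l) x := hd.isSymmSndFDerivAt (by
      rw [minSmoothness_of_isRCLikeNormedField]
      exact WithTop.coe_le_coe.2 (le_top : (2 : ℕ∞) ≤ ⊤))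
    simp only [listDeriv]
    rw [fderiv_clm_apply hd1 (by fun_prop), fderiv_clm_apply hd1 (by fun_prop)]
    simpa using hs _ _
  | trans _ _ ih ih' => exact ih.trans ih'

theorem SmoothUpTo.exists_listDeriv {S : Set (ι → ℝ)} {f : (ι → ℝ) → F} (hf : SmoothUpTo S f)
    (l : List ι) : ∃ g, SmoothUpTo S g ∧ EqOn g (listDeriv f l) (interior S) := by
  induction l with
  | nil => exact ⟨f, hf, fun _ _ => rfl⟩
  | cons i l ih =>
    obtain ⟨g, hg, hgl⟩ := ih
    obtain ⟨g', hg', hs⟩ := hg.exists_fderiv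
    refine ⟨fun x => ContinuousLinearMap.apply ℝ F (Pi.single i 1 : ι → ℝ) (g' x),
      smoothUpTo_of_forall_ckUpTo fun n => (hs.ckUpTo n).clm_comp _, fun x hx => ?_⟩
    have : g =ᶠ[𝓝 x] listDeriv f l := hgl.eventuallyEq_of_mem (isOpen_interior.mem_nhds hx)
    simp [listDeriv, ← this.fderiv_eq, (hg' x hx).fderiv]

/-- A function in `C^∞(S)` has a family of continuous functions on `S` representing its partial
derivatives. -/
theorem SmoothUpTo.exists_partials {S : Set (ι → ℝ)} {f : (ι → ℝ) → F} (hf : SmoothUpTo S f)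
    (hS : S ⊆ closure (interior S)) :
    ∃ E : (ι → ℕ) → (ι → ℝ) → F, EqOn (E 0) f S ∧ (∀ α, ContinuousOn (E α) S) ∧
      ∀ α i, ∀ x ∈ interior S,
        HasDerivAt (fun ξ => E α (Function.update x i ξ)) (E (α + Pi.single i 1) x) (x i) := by
  choose g hg hgl using hf.exists_listDeriv
  let M : (ι → ℕ) → Multiset ι := fun α => ∑ i, α i • {i}
  have hM0 : (M 0).toList = [] := by simp [M]
  have hM1 : ∀ α i, ((M (α + Pi.single i 1)).toList).Perm (i :: (M α).toList) := by
    intro α i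
    rw [← Multiset.coe_eq_coe, Multiset.coe_toList, ← Multiset.cons_coe, Multiset.coe_toList]
    simp only [M, Pi.add_apply, add_smul, Finset.sum_add_distrib, Pi.single_apply, ite_smul,
      one_smul, zero_smul, Finset.sum_ite_eq', Finset.mem_univ, if_true]
    rw [add_comm, Multiset.singleton_add]
  have hderiv : ∀ (l l' : List ι) (i : ι), l'.Perm (i :: l) → ∀ x ∈ interior S,
      HasDerivAt (fun ξ => g l (Function.update x i ξ)) (g l' x) (x i) := by
    intro l l' i hl x hx
    have hx' := isOpen_interior.mem_nhds hx
    have h1 : g l =ᶠ[𝓝 x] listDeriv f l := (hgl l).eventuallyEq_of_mem hx'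
    have h2 : HasFDerivAt (g l) (fderiv ℝ (g l) x) x :=
      (((hg l).2.1.differentiableOn (by simp)).differentiableAt hx').hasFDerivAt
    have h3 : g l' x = fderiv ℝ (g l) x (Pi.single i 1) := by
      rw [hgl l' hx, listDeriv_perm isOpen_interior hf.2.1 hl hx, h1.fderiv_eq]
      rfl
    rw [h3]
    refine HasFDerivAt.comp_hasDerivAt (x i) ?_ (hasDerivAt_update x i (x i))
    rwa [Function.update_eq_self]
  refine ⟨fun α => g (M α).toList, ?_, fun α => (hg _).1, fun α i => hderiv _ _ i (hM1 α i)⟩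
  beta_reduce
  rw [hM0]
  exact EqOn.of_subset_closure (hgl []) (hg _).1 hf.1 interior_subset hS

end SpaceJet

/-! ### The jet of the initial polynomial -/

section InitialJet

/-- The `γ`-th derivative of `t ↦ (t - t₀)^j / j!`. -/
noncomputable def taylorCoeff (t₀ : ℝ) (j γ : ℕ) (t : ℝ) : ℝ :=
  if γ ≤ j then (t - t₀) ^ (j - γ) / ((j - γ).factorial : ℝ) else 0

theorem hasDerivAt_taylorCoeff (t₀ : ℝ) (j γ : ℕ) (t : ℝ) :
    HasDerivAt (taylorCoeff t₀ j γ) (taylorCoeff t₀ j (γ + 1) t) t := by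
  unfold taylorCoeff
  rcases lt_trichotomy γ j with h | h | h
  · obtain ⟨n, hn⟩ : ∃ n, j - γ = n + 1 := ⟨j - γ - 1, by lia⟩
    have hn' : j - (γ + 1) = n := by lia
    rw [if_pos (by lia : γ + 1 ≤ j), hn']
    simp only [if_pos h.le, hn]
    refine ((((hasDerivAt_id t).sub_const t₀).pow (n + 1)).div_const _).congr_deriv ?_
    have : (n.factorial : ℝ) ≠ 0 := by positivity
    have : (n : ℝ) + 1 ≠ 0 := by positivity
    simp only [Nat.factorial_succ, id]
    push_cast
    field_simp
  · subst h
    simpa using hasDerivAt_const t (1 : ℝ)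
  · rw [if_neg (by lia)]
    simpa only [if_neg (by lia : ¬ γ ≤ j)] using hasDerivAt_const t (0 : ℝ)

theorem continuous_taylorCoeff (t₀ : ℝ) (j γ : ℕ) : Continuous (taylorCoeff t₀ j γ) :=
  continuous_iff_continuousAt.2 fun t => (hasDerivAt_taylorCoeff t₀ j γ t).continuousAt

theorem taylorCoeff_initial (t₀ : ℝ) (j γ : ℕ) :
    taylorCoeff t₀ j γ t₀ = if j = γ then 1 else 0 := by
  unfold taylorCoeff
  rcases lt_trichotomy γ j with h | h | h
  · rw [if_pos h.le, if_neg (by lia), sub_self, zero_pow (by lia), zero_div]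
  · simp [h]
  · rw [if_neg (by lia), if_neg (by lia)]

variable {s m d : ℕ} {t₀ a b : ℝ} {S : Set (Fin s → ℝ)} {y₀ : Fin d → (Fin s → ℝ) → (Fin m → ℝ)}

/-- The initial polynomial has a jet of every order; its `d`-th time derivative vanishes, and its
time derivatives of lower order at `t₀` are the initial data. -/
theorem exists_isJet_initialPoly (hS : S ⊆ closure (interior S))
    (hy : ∀ j, SmoothUpTo S (y₀ j)) :
    ∃ D, (∀ q, IsJet (cylinder t₀ a b S) q (initialPoly t₀ y₀) D) ∧
      (∀ α z, D (d, α) z = 0) ∧ ∀ j : Fin d, ∀ x ∈ S, D (j, 0) (t₀, x) = y₀ j x := by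
  choose E hE0 hEc hEd using fun j => (hy j).exists_partials hS
  refine ⟨fun β z => ∑ j : Fin d, taylorCoeff t₀ j β.1 z.1 • E j β.2 z.2,
    fun q => ⟨fun z hz => ?_, fun γ α _ => ?_, fun γ α _ z hz => ?_, fun γ α _ i z hz => ?_⟩,
    fun α z => ?_, fun j x hx => ?_⟩
  · refine Finset.sum_congr rfl fun j _ => ?_
    rw [Prod.snd_zero, hE0 j hz.2]
    simp [taylorCoeff]
  · refine continuousOn_finsetSum _ fun j _ => ContinuousOn.fun_smul ?_ ?_
    · exact ((continuous_taylorCoeff t₀ j γ).comp continuous_fst).continuousOn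
    · exact (hEc j α).comp continuous_snd.continuousOn fun z hz => hz.2
  · refine HasDerivAt.fun_sum fun j _ => ?_
    exact (hasDerivAt_taylorCoeff t₀ j γ z.1).smul_const (E j α z.2)
  · rw [interior_cylinder] at hz
    refine HasDerivAt.fun_sum fun j _ => ?_
    exact (hEd j α i z.2 hz.2).fun_const_smul (taylorCoeff t₀ j γ z.1)
  · refine Finset.sum_eq_zero fun j _ => ?_
    have := j.2
    rw [taylorCoeff, if_neg (by simp), zero_smul]
  · simp only [taylorCoeff_initial, ite_smul, one_smul, zero_smul, ← Fin.ext_iff,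
      Finset.sum_ite_eq', Finset.mem_univ, if_true]
    exact hE0 j hx

end InitialJet

/-! ### Smoothness of solutions up to the boundary -/

section Regularity

variable {s m p L d : ℕ} {t₀ a b : ℝ} {S : Set (Fin s → ℝ)} {Ω : Set (ℝ × (Fin s → ℝ))}
  {y g : ℝ × (Fin s → ℝ) → (Fin m → ℝ)}
  {D E : ℕ × (Fin s → ℕ) → ℝ × (Fin s → ℝ) → (Fin m → ℝ)}

theorem hasDerivAt_mk_update (i : Fin s) (z : ℝ × (Fin s → ℝ)) :
    HasDerivAt (fun ξ => (z.1, Function.update z.2 i ξ)) ((0 : ℝ), (Pi.single i 1 : Fin s → ℝ))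
      (z.2 i) :=
  (hasDerivAt_const (z.2 i) z.1).prodMk (hasDerivAt_update z.2 i (z.2 i))

/-- The set `Ω × (ℝ^m)^J` on which a function of the point and of finitely many derivatives of an
unknown function is defined. -/
def jetDomain (Ω : Set (ℝ × (Fin s → ℝ))) (m : ℕ) (J : Type) :
    Set ((ℝ × (Fin s → ℝ)) × (J → (Fin m → ℝ))) :=
  Ω ×ˢ univ

theorem interior_jetDomain {J : Type} : interior (jetDomain Ω m J) = interior Ω ×ˢ univ := by
  rw [jetDomain, interior_prod_eq, interior_univ]

/-- If a function of the derivatives `∂^β y`, `β = idx j`, is smooth in all its arguments, then its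
composition with `y` is as often differentiable as those derivatives are. -/
theorem CkUpTo.comp_jet {n : ℕ} {J : Type} [Fintype J] {idx : J → ℕ × (Fin s → ℕ)}
    {H : (ℝ × (Fin s → ℝ)) × (J → (Fin m → ℝ)) → (Fin m → ℝ)}
    (hH : CkUpTo (jetDomain Ω m J) n H) (hD : ∀ j, CkUpTo Ω n (D (idx j))) :
    CkUpTo Ω n fun z => H (z, fun j => D (idx j) z) := by
  refine comp (φ := fun z => (z, fun j => D (idx j) z)) hH
    ((of_contDiff contDiff_id).prodMk (pi hD)) (fun z hz => ⟨hz, mem_univ _⟩) fun z hz => ?_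
  rw [interior_jetDomain]
  exact ⟨hz, mem_univ _⟩

/-- The total derivative in `x_i` of a smooth function `H` of `(t, x)` and of derivatives of `y` is
a smooth function of `(t, x)`, of the same derivatives of `y`, and of their derivatives in `x_i`. -/
theorem exists_totalDeriv (hΩ : Ω ⊆ closure (interior Ω)) (hJ : IsJet Ω d y D)
    (hE : IsJet Ω 0 g E) {α : Fin s → ℕ} (i : Fin s) {J : Type} [Fintype J]
    {idx : J → ℕ × (Fin s → ℕ)} (hidx : ∀ j, (idx j).1 ≤ d)
    {H : (ℝ × (Fin s → ℝ)) × (J → (Fin m → ℝ)) → (Fin m → ℝ)}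
    (hH : SmoothUpTo (jetDomain Ω m J) H)
    (hEH : ∀ z ∈ Ω, E (0, α) z = H (z, fun j => D (idx j) z)) :
    ∃ H' : (ℝ × (Fin s → ℝ)) × (J ⊕ J → (Fin m → ℝ)) → (Fin m → ℝ),
      SmoothUpTo (jetDomain Ω m (J ⊕ J)) H' ∧ ∀ z ∈ Ω, E (0, α + Pi.single i 1) z =
        H' (z, fun j => D (Sum.elim idx (fun j => idx j + (0, Pi.single i 1)) j) z) := by
  obtain ⟨H₁, hH₁, hs₁⟩ := hH.exists_fderiv
  have hs : ∀ n, CkUpTo (jetDomain Ω m (J ⊕ J)) n fun w =>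
      H₁ (w.1, fun j => w.2 (Sum.inl j))
        (((0 : ℝ), (Pi.single i 1 : Fin s → ℝ)), fun j => w.2 (Sum.inr j)) := by
    intro n
    refine CkUpTo.bilinear (ContinuousLinearMap.id ℝ
      ((ℝ × (Fin s → ℝ)) × (J → (Fin m → ℝ)) →L[ℝ] (Fin m → ℝ))) ?_ ?_
    · refine CkUpTo.comp (φ := fun w : (ℝ × (Fin s → ℝ)) × (J ⊕ J → (Fin m → ℝ)) =>
        (w.1, fun j => w.2 (Sum.inl j))) (hs₁.ckUpTo n)
        (CkUpTo.of_contDiff (by fun_prop)) (fun w hw => ⟨hw.1, mem_univ _⟩) fun w hw => ?_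
      rw [interior_jetDomain] at hw ⊢
      exact ⟨hw.1, mem_univ _⟩
    · exact CkUpTo.of_contDiff (by fun_prop)
  refine ⟨_, smoothUpTo_of_forall_ckUpTo hs, ?_⟩
  refine EqOn.of_subset_closure (s := interior Ω) (fun z hz => ?_) (hE.2.1 0 _ le_rfl) ?_
    interior_subset hΩ
  · have hz' := isOpen_interior.mem_nhds hz
    have h1 := hE.2.2.2 0 α le_rfl i z hz
    have h2 : HasDerivAt (fun ξ => ((z.1, Function.update z.2 i ξ),
        fun j => D (idx j) (z.1, Function.update z.2 i ξ)))
        (((0 : ℝ), (Pi.single i 1 : Fin s → ℝ)), fun j => D (idx j + (0, Pi.single i 1)) z)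
        (z.2 i) :=
      (hasDerivAt_mk_update i z).prodMk
        (hasDerivAt_pi.2 fun j => hJ.2.2.2 _ _ (hidx j) i z hz)
    have h3 : HasFDerivAt H (H₁ (z, fun j => D (idx j) z))
        ((z.1, Function.update z.2 i (z.2 i)),
          fun j => D (idx j) (z.1, Function.update z.2 i (z.2 i))) := by
      rw [Function.update_eq_self]
      refine hH₁ _ ?_
      rw [interior_jetDomain]
      exact ⟨hz, mem_univ _⟩
    refine h1.unique ((h3.comp_hasDerivAt (z.2 i) h2).congr_of_eventuallyEq ?_)
    filter_upwards [(tendsto_lineX i z).eventually hz'] with ξ hξ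
    exact hEH _ (interior_subset hξ)
  · refine (hs 0).continuousOn.comp (f := fun z => (z, fun j => D (Sum.elim idx
      (fun j => idx j + (0, Pi.single i 1)) j) z)) (continuousOn_id.prodMk
        (continuousOn_pi.2 fun j => ?_)) fun z hz => ⟨hz, mem_univ _⟩
    rcases j with j | j
    · exact hJ.2.1 _ _ (hidx j)
    · exact hJ.2.1 (idx j).1 ((idx j).2 + Pi.single i 1) (hidx j)

/-- Every space derivative of `F[t, x, (∂^β y)_β]` is a smooth function of `(t, x)` and of finitely
many derivatives of `y`, of time order at most `p`. -/
theorem exists_prolongation (hΩ : Ω ⊆ closure (interior Ω)) (hpd : p ≤ d) (hJ : IsJet Ω d y D)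
    (hE : IsJet Ω 0 g E) {H₀ : (ℝ × (Fin s → ℝ)) × (jetIdx s p L → (Fin m → ℝ)) → (Fin m → ℝ)}
    (hH₀ : SmoothUpTo (jetDomain Ω m (jetIdx s p L)) H₀)
    (hg : ∀ z ∈ Ω, g z = H₀ (z, fun β => D β z)) (α : Fin s → ℕ) :
    ∃ (J : Type) (_ : Fintype J) (idx : J → ℕ × (Fin s → ℕ))
      (H : (ℝ × (Fin s → ℝ)) × (J → (Fin m → ℝ)) → (Fin m → ℝ)), (∀ j, (idx j).1 ≤ p) ∧
      SmoothUpTo (jetDomain Ω m J) H ∧ ∀ z ∈ Ω, E (0, α) z = H (z, fun j => D (idx j) z) := by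
  induction hn : ∑ i, α i generalizing α with
  | zero =>
    have hα : α = 0 := funext fun i => by
      simpa using Finset.sum_eq_zero_iff.1 hn i (Finset.mem_univ i)
    subst hα
    refine ⟨jetIdx s p L, inferInstance, Subtype.val, H₀, fun β => ?_, hH₀,
      fun z hz => (hE.1 hz).trans (hg z hz)⟩
    have := (Finset.mem_product.1 β.2).1
    rw [Finset.mem_range] at this
    lia
  | succ n ih =>
    obtain ⟨i, hi⟩ : ∃ i, α i ≠ 0 := by
      by_contra! h
      simp [h] at hn
    have hα : (α - Pi.single i 1 : Fin s → ℕ) + Pi.single i 1 = α := by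
      ext j
      by_cases hj : j = i
      · subst hj; simp; lia
      · simp [hj]
    have hn' : ∑ j, (α - Pi.single i 1 : Fin s → ℕ) j = n := by
      have := congrArg (fun β => ∑ j, β j) hα
      simp only [Pi.add_apply, Finset.sum_add_distrib, Finset.sum_pi_single', Finset.mem_univ,
        if_true] at this
      lia
    obtain ⟨J, _, idx, H, hidx, hH, hEH⟩ := ih _ hn'
    obtain ⟨H', hH', hEH'⟩ :=
      exists_totalDeriv hΩ hJ hE i (fun j => (hidx j).trans hpd) hH hEH
    rw [hα] at hEH'
    refine ⟨J ⊕ J, inferInstance, _, H', fun j => ?_, hH', hEH'⟩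
    rcases j with j | j
    · exact hidx j
    · exact hidx j

/-- A function with `∂_t^d ∂_x^α y = ∂_x^α F[t, x, (∂^β y)_β]` for all `α`, where `F` is smooth and
contains time derivatives of order less than `d` only, is smooth up to the boundary. The claim that
all `∂_x^α ∂_t^γ y`, `γ ≤ d`, are of class `C^n` is proved by induction on `n`: for `γ < d` their
first derivatives are of the same form, and for `γ = d` they are smooth functions of the others. -/
theorem smoothUpTo_of_isJet (hΩ : Ω ⊆ closure (interior Ω)) (hpd : p < d) (hJ : IsJet Ω d y D)
    (hE : IsJet Ω 0 g E) {H₀ : (ℝ × (Fin s → ℝ)) × (jetIdx s p L → (Fin m → ℝ)) → (Fin m → ℝ)}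
    (hH₀ : SmoothUpTo (jetDomain Ω m (jetIdx s p L)) H₀)
    (hg : ∀ z ∈ Ω, g z = H₀ (z, fun β => D β z))
    (hDE : ∀ α, EqOn (D (d, α)) (E (0, α)) Ω) : SmoothUpTo Ω y := by
  have key : ∀ n γ α, γ ≤ d → CkUpTo Ω n (D (γ, α)) := by
    intro n
    induction n with
    | zero => exact fun γ α hγ => hJ.2.1 γ α hγ
    | succ n ih =>
      have hlt : ∀ γ α, γ < d → CkUpTo Ω (n + 1) (D (γ, α)) := fun γ α hγ =>
        CkUpTo.succ_of_partials (hJ.2.1 γ α hγ.le) (ih (γ + 1) α hγ) (fun i => ih γ _ hγ.le)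
          (hJ.2.2.1 γ α hγ) (hJ.2.2.2 γ α hγ.le)
      intro γ α hγ
      rcases hγ.lt_or_eq with h | rfl
      · exact hlt γ α h
      · obtain ⟨J, _, idx, H, hidx, hH, hEH⟩ :=
          exists_prolongation hΩ hpd.le hJ hE hH₀ hg α
        refine (CkUpTo.comp_jet (idx := idx) (hH.ckUpTo (n + 1)) fun j =>
          hlt _ _ ((hidx j).trans_lt hpd)).congr fun z hz => ?_
        rw [hDE α hz, hEH z hz]
  exact smoothUpTo_of_forall_ckUpTo fun n => (key n 0 0 (Nat.zero_le d)).congr hJ.1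

theorem SmoothUpTo.jetDomain_of_rhsDomain
    {F : ℝ × (Fin s → ℝ) × (jetIdx s p L → (Fin m → ℝ)) → (Fin m → ℝ)}
    (hF : SmoothUpTo (rhsDomain m p L t₀ a b S) F) :
    SmoothUpTo (jetDomain (cylinder t₀ a b S) m (jetIdx s p L))
      fun w => F (w.1.1, w.1.2, w.2) := by
  refine smoothUpTo_of_forall_ckUpTo fun n => CkUpTo.comp
    (φ := fun w : (ℝ × (Fin s → ℝ)) × (jetIdx s p L → (Fin m → ℝ)) => (w.1.1, w.1.2, w.2))
    (hF.ckUpTo n) (CkUpTo.of_contDiff (by fun_prop))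
    (fun w hw => ⟨hw.1.1, hw.1.2, mem_univ _⟩) fun w hw => ?_
  rw [interior_jetDomain, interior_cylinder] at hw
  rw [rhsDomain, interior_prod_eq, interior_prod_eq, interior_Icc, interior_univ]
  exact ⟨hw.1.1, hw.1.2, mem_univ _⟩

end Regularity

/-! ### Norms and limits -/

section Norms

variable {s m p : ℕ} {Ω : Set (ℝ × (Fin s → ℝ))} {y v : ℝ × (Fin s → ℝ) → (Fin m → ℝ)}

theorem mem_spaceIdx {K : ℕ} {α : Fin s → ℕ} : α ∈ spaceIdx s K ↔ ∑ i, α i ≤ K := by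
  simp only [spaceIdx, Finset.mem_filter, Fintype.mem_piFinset, Finset.mem_range,
    and_iff_right_iff_imp]
  intro h i
  have := Finset.single_le_sum (fun j _ => Nat.zero_le (α j)) (Finset.mem_univ i)
  lia

theorem mem_jetIdx {K : ℕ} {β : ℕ × (Fin s → ℕ)} :
    β ∈ jetIdx s p K ↔ β.1 ≤ p ∧ ∑ i, β.2 i ≤ K := by
  rw [jetIdx, Finset.mem_product, mem_spaceIdx, Finset.mem_range, Nat.lt_succ_iff]

theorem zero_mem_jetIdx (K : ℕ) : (0, 0) ∈ jetIdx s p K := mem_jetIdx.2 (by simp)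

theorem spaceNorm_le_iff {k : ℕ} {c : ℝ≥0∞} :
    spaceNorm Ω p k y ≤ c ↔ ∀ β ∈ jetIdx s p k, ∀ z ∈ Ω, ‖derivOn Ω β y z‖ₑ ≤ c := by
  simp only [spaceNorm, iSup_le_iff]

theorem gradedNorm_le_iff {k : ℕ} {c : ℝ≥0∞} : gradedNorm Ω p k y ≤ c ↔
    ∀ β : ℕ × (Fin s → ℕ), β.1 ≤ p → β.1 + ∑ i, β.2 i ≤ k →
      ∀ z ∈ Ω, ‖derivOn Ω β y z‖ₑ ≤ c := by
  simp only [gradedNorm, iSup_le_iff, mem_ofPred_eq, and_imp]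

theorem gradedNorm_le_spaceNorm (k : ℕ) : gradedNorm Ω p k y ≤ spaceNorm Ω p k y :=
  gradedNorm_le_iff.2 fun β h1 h2 z hz =>
    spaceNorm_le_iff.1 le_rfl β (mem_jetIdx.2 ⟨h1, by lia⟩) z hz

theorem spaceNorm_lt_top (hΩ : Ω ⊆ closure (interior Ω)) (hc : IsCompact Ω)
    (hy : SepRegular Ω p y) (k : ℕ) : spaceNorm Ω p k y < ⊤ := by
  have hb : ∀ β ∈ jetIdx s p k, ∃ C : ℝ, ∀ z ∈ Ω, ‖derivOn Ω β y z‖ ≤ C := fun β hβ =>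
    hc.exists_bound_of_continuousOn ((hy.isJet hΩ).2.1 β.1 β.2 (mem_jetIdx.1 hβ).1)
  choose! C hC using hb
  refine lt_of_le_of_lt (spaceNorm_le_iff.2 fun β hβ z hz => ?_)
    (ENNReal.ofReal_lt_top (r := ∑ β ∈ jetIdx s p k, |C β|))
  rw [← ofReal_norm]
  exact ENNReal.ofReal_le_ofReal (((hC β hβ z hz).trans (le_abs_self _)).trans
    (Finset.single_le_sum (fun β _ => abs_nonneg (C β)) hβ))

theorem enorm_derivOn_sub_comm (hΩ : Ω ⊆ closure (interior Ω)) (hy : SepRegular Ω p y)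
    (hv : SepRegular Ω p v) {β : ℕ × (Fin s → ℕ)} (hβ : β.1 ≤ p) {z : ℝ × (Fin s → ℝ)}
    (hz : z ∈ Ω) : ‖derivOn Ω β (y - v) z‖ₑ = ‖derivOn Ω β (v - y) z‖ₑ := by
  rw [derivOn_sub hy hv hΩ hβ hz, derivOn_sub hv hy hΩ hβ hz, ← edist_eq_enorm_sub,
    ← edist_eq_enorm_sub, edist_comm]

theorem spaceNorm_sub_comm (hΩ : Ω ⊆ closure (interior Ω)) (hy : SepRegular Ω p y)
    (hv : SepRegular Ω p v) (k : ℕ) : spaceNorm Ω p k (y - v) = spaceNorm Ω p k (v - y) := by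
  refine le_antisymm ?_ ?_ <;> refine spaceNorm_le_iff.2 fun β hβ z hz => ?_
  · rw [enorm_derivOn_sub_comm hΩ hy hv (mem_jetIdx.1 hβ).1 hz]
    exact spaceNorm_le_iff.1 le_rfl β hβ z hz
  · rw [enorm_derivOn_sub_comm hΩ hv hy (mem_jetIdx.1 hβ).1 hz]
    exact spaceNorm_le_iff.1 le_rfl β hβ z hz

theorem tendsto_tsum_tail {A : ℕ → ℝ≥0∞} (hA : ∑' n, A n ≠ ⊤) :
    Tendsto (fun N => ∑' n, A (N + n)) atTop (𝓝 0) := by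
  simpa only [add_comm] using ENNReal.tendsto_sum_nat_add A hA

/-- Completeness of `C_t^p C_x^∞(Ω)`: a sequence whose increments are summable in every norm
`|||·|||_k` converges, and the distance to the limit is bounded by the tail of the series. -/
theorem exists_limit_of_summable_increments (hΩ : Ω ⊆ closure (interior Ω))
    {u : ℕ → ℝ × (Fin s → ℝ) → (Fin m → ℝ)} (hu : ∀ n, SepRegular Ω p (u n))
    {A : ℕ → ℕ → ℝ≥0∞} (hA : ∀ k n, spaceNorm Ω p k (u (n + 1) - u n) ≤ A k n)
    (hsum : ∀ k, ∑' n, A k n ≠ ⊤) :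
    ∃ y, SepRegular Ω p y ∧ ∀ k N, spaceNorm Ω p k (y - u N) ≤ ∑' n, A k (N + n) := by
  have hstep : ∀ k, ∀ β ∈ jetIdx s p k, ∀ z ∈ Ω, ∀ n,
      edist (derivOn Ω β (u n) z) (derivOn Ω β (u n.succ) z) ≤ A k n := by
    intro k β hβ z hz n
    rw [edist_comm, edist_eq_enorm_sub,
      ← derivOn_sub (hu (n + 1)) (hu n) hΩ (mem_jetIdx.1 hβ).1 hz]
    exact spaceNorm_le_iff.1 (hA k n) β hβ z hz
  let D : ℕ × (Fin s → ℕ) → ℝ × (Fin s → ℝ) → (Fin m → ℝ) :=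
    fun β z => limUnder atTop fun n => derivOn Ω β (u n) z
  have hlim : ∀ k, ∀ β ∈ jetIdx s p k, ∀ z ∈ Ω,
      Tendsto (fun n => derivOn Ω β (u n) z) atTop (𝓝 (D β z)) := fun k β hβ z hz =>
    (cauchySeq_of_edist_le_of_tsum_ne_top (A k) (hstep k β hβ z hz) (hsum k)).tendsto_limUnder
  have htail : ∀ k, ∀ β ∈ jetIdx s p k, ∀ z ∈ Ω, ∀ N,
      edist (derivOn Ω β (u N) z) (D β z) ≤ ∑' n, A k (N + n) := fun k β hβ z hz N =>
    edist_le_tsum_of_edist_le_of_tendsto (A k) (hstep k β hβ z hz) (hlim k β hβ z hz) N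
  have hself : ∀ γ (α : Fin s → ℕ), γ ≤ p → (γ, α) ∈ jetIdx s p (∑ i, α i) :=
    fun γ α hγ => mem_jetIdx.2 ⟨hγ, le_rfl⟩
  have hunif : ∀ γ α, γ ≤ p →
      TendstoUniformlyOn (fun n => derivOn Ω (γ, α) (u n)) (D (γ, α)) atTop Ω := by
    intro γ α hγ
    rw [EMetric.tendstoUniformlyOn_iff]
    intro ε hε
    filter_upwards [(tendsto_tsum_tail (hsum (∑ i, α i))).eventually (gt_mem_nhds hε)] with N hN
    intro z hz
    rw [edist_comm]
    exact (htail _ _ (hself γ α hγ) z hz N).trans_lt hN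
  have hJ : IsJet Ω p (D 0) D := by
    refine ⟨fun _ _ => rfl, fun γ α hγ => ?_, fun γ α hγ z hz => ?_, fun γ α hγ i z hz => ?_⟩
    · exact (hunif γ α hγ).continuousOn
        (Eventually.of_forall fun n => ((hu n).isJet hΩ).2.1 γ α hγ).frequently
    · refine hasDerivAt_of_tendstoUniformlyOn (l := atTop)
        (s := {τ : ℝ | (τ, z.2) ∈ interior Ω}) (f := fun n τ => derivOn Ω (γ, α) (u n) (τ, z.2))
        (f' := fun n τ => derivOn Ω (γ + 1, α) (u n) (τ, z.2))
        (g' := fun τ => D (γ + 1, α) (τ, z.2))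
        (isOpen_interior.preimage (Continuous.prodMk_left z.2)) ?_ ?_ ?_ hz
      · exact ((hunif (γ + 1) α hγ).comp fun τ => (τ, z.2)).mono
          fun τ hτ => interior_subset (s := Ω) hτ
      · exact Eventually.of_forall fun n τ hτ => ((hu n).isJet hΩ).2.2.1 γ α hγ (τ, z.2) hτ
      · exact fun τ hτ => hlim _ _ (hself γ α hγ.le) _ (interior_subset hτ)
    · have key := hasDerivAt_of_tendstoUniformlyOn (l := atTop)
        (s := {ξ : ℝ | (z.1, Function.update z.2 i ξ) ∈ interior Ω})
        (f := fun n ξ => derivOn Ω (γ, α) (u n) (z.1, Function.update z.2 i ξ))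
        (f' := fun n ξ => derivOn Ω (γ, α + Pi.single i 1) (u n) (z.1, Function.update z.2 i ξ))
        (g := fun ξ => D (γ, α) (z.1, Function.update z.2 i ξ))
        (g' := fun ξ => D (γ, α + Pi.single i 1) (z.1, Function.update z.2 i ξ)) (x := z.2 i)
        (isOpen_interior.preimage (by fun_prop)) ?_ ?_ ?_ (by simpa using hz)
      · simpa using key
      · exact ((hunif γ (α + Pi.single i 1) hγ).comp
          fun ξ => (z.1, Function.update z.2 i ξ)).mono fun ξ hξ => interior_subset (s := Ω) hξ
      · refine Eventually.of_forall fun n ξ hξ => ?_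
        have := ((hu n).isJet hΩ).2.2.2 γ α hγ i _ hξ
        simpa using this
      · exact fun ξ hξ => hlim _ _ (hself γ α hγ) _ (interior_subset hξ)
  refine ⟨D 0, hJ.sepRegular, fun k N => spaceNorm_le_iff.2 fun β hβ z hz => ?_⟩
  have hβ1 := (mem_jetIdx.1 hβ).1
  rw [derivOn_sub hJ.sepRegular (hu N) hΩ hβ1 hz, hJ.derivOn_eq hΩ hβ1 hz,
    ← edist_eq_enorm_sub, edist_comm]
  exact htail k β hβ z hz N

theorem tendsto_derivOn_of_spaceNorm (hΩ : Ω ⊆ closure (interior Ω))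
    {u : ℕ → ℝ × (Fin s → ℝ) → (Fin m → ℝ)} (hu : ∀ n, SepRegular Ω p (u n))
    (hy : SepRegular Ω p y) {k : ℕ}
    (h : Tendsto (fun n => spaceNorm Ω p k (y - u n)) atTop (𝓝 0)) {β : ℕ × (Fin s → ℕ)}
    (hβ : β ∈ jetIdx s p k) {z : ℝ × (Fin s → ℝ)} (hz : z ∈ Ω) :
    Tendsto (fun n => derivOn Ω β (u n) z) atTop (𝓝 (derivOn Ω β y z)) := by
  rw [tendsto_iff_edist_tendsto_0]
  refine tendsto_of_tendsto_of_tendsto_of_le_of_le tendsto_const_nhds h (fun _ => zero_le)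
    fun n => ?_
  beta_reduce
  rw [edist_comm, edist_eq_enorm_sub, ← derivOn_sub hy (hu n) hΩ (mem_jetIdx.1 hβ).1 hz]
  exact spaceNorm_le_iff.1 le_rfl β hβ z hz

/-- The balls of `C_t^p C_x^∞(Ω)` are closed. -/
theorem mem_gradedBall_of_tendsto (hΩ : Ω ⊆ closure (interior Ω)) {r : ℕ → ℝ≥0∞}
    {i₀ : ℝ × (Fin s → ℝ) → (Fin m → ℝ)} (hi : SepRegular Ω p i₀)
    {u : ℕ → ℝ × (Fin s → ℝ) → (Fin m → ℝ)} (hu : ∀ n, u n ∈ gradedBall Ω p r i₀)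
    (hy : SepRegular Ω p y)
    (h : ∀ k, Tendsto (fun n => spaceNorm Ω p k (y - u n)) atTop (𝓝 0)) :
    y ∈ gradedBall Ω p r i₀ := by
  refine ⟨hy, fun k => gradedNorm_le_iff.2 fun β h1 h2 z hz => ?_⟩
  have hβ : β ∈ jetIdx s p k := mem_jetIdx.2 ⟨h1, by lia⟩
  have hlim := tendsto_derivOn_of_spaceNorm hΩ (fun n => (hu n).1) hy (h k) hβ hz
  rw [derivOn_sub hy hi hΩ h1 hz]
  refine le_of_tendsto ((hlim.sub_const (derivOn Ω β i₀ z)).enorm)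
    (Eventually.of_forall fun n => ?_)
  rw [← derivOn_sub (hu n).1 hi hΩ h1 hz]
  exact gradedNorm_le_iff.1 ((hu n).2 k) β h1 h2 z hz

theorem mem_gradedBall_self (hΩ : Ω ⊆ closure (interior Ω)) {r : ℕ → ℝ≥0∞}
    (hy : SepRegular Ω p y) : y ∈ gradedBall Ω p r y := by
  refine ⟨hy, fun k => gradedNorm_le_iff.2 fun β h1 _ z hz => ?_⟩
  rw [derivOn_sub hy hy hΩ h1 hz, sub_self, enorm_zero]
  exact zero_le

end Norms

/-! ### The Picard operator -/

section Picard

variable {s m p d L : ℕ} {t₀ a b : ℝ} {S : Set (Fin s → ℝ)}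
  {i₀ u v : ℝ × (Fin s → ℝ) → (Fin m → ℝ)} {r : ℕ → ℝ≥0∞}
  {B : Set (ℝ × (Fin s → ℝ) → (Fin m → ℝ))}
  {G : (ℝ × (Fin s → ℝ) → (Fin m → ℝ)) → ℝ × (Fin s → ℝ) → (Fin m → ℝ)}
  {D : ℕ × (Fin s → ℕ) → ℝ × (Fin s → ℝ) → (Fin m → ℝ)}
  {Λ : ℕ → ℝ × (Fin s → ℝ) → ℝ}

theorem isJet_picard (ha : 0 < a) (hb : 0 < b) (hS : IsCompact S) (hSint : S ⊆ closure (interior S))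
    (hi : IsJet (cylinder t₀ a b S) d i₀ D) (hG : SepRegular (cylinder t₀ a b S) 0 (G u)) :
    IsJet (cylinder t₀ a b S) d (picard t₀ d i₀ G u)
      (D + fun β => iterIntT t₀ (d - β.1) (derivOn (cylinder t₀ a b S) (0, β.2) (G u))) :=
  hi.add ((hG.isJet (cylinder_subset_closure_interior ha hb hSint)).iterIntT ha hb hS d)

theorem derivOn_picard_sub_initial (ha : 0 < a) (hb : 0 < b) (hS : IsCompact S)
    (hSint : S ⊆ closure (interior S)) (hi : IsJet (cylinder t₀ a b S) d i₀ D)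
    (hG : SepRegular (cylinder t₀ a b S) 0 (G u)) {β : ℕ × (Fin s → ℕ)} (hβ : β.1 ≤ d)
    {z : ℝ × (Fin s → ℝ)} (hz : z ∈ cylinder t₀ a b S) :
    derivOn (cylinder t₀ a b S) β (picard t₀ d i₀ G u - i₀) z =
      iterIntT t₀ (d - β.1) (derivOn (cylinder t₀ a b S) (0, β.2) (G u)) z := by
  have hΩ := cylinder_subset_closure_interior (t₀ := t₀) ha hb hSint
  rw [((isJet_picard ha hb hS hSint hi hG).sub hi).derivOn_eq hΩ hβ hz]
  simp

theorem derivOn_picard_sub_picard (ha : 0 < a) (hb : 0 < b) (hS : IsCompact S)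
    (hSint : S ⊆ closure (interior S)) (hi : IsJet (cylinder t₀ a b S) d i₀ D)
    (hGu : SepRegular (cylinder t₀ a b S) 0 (G u)) (hGv : SepRegular (cylinder t₀ a b S) 0 (G v))
    {β : ℕ × (Fin s → ℕ)} (hβ : β.1 ≤ d) {z : ℝ × (Fin s → ℝ)} (hz : z ∈ cylinder t₀ a b S) :
    derivOn (cylinder t₀ a b S) β (picard t₀ d i₀ G u - picard t₀ d i₀ G v) z =
      iterIntT t₀ (d - β.1) (derivOn (cylinder t₀ a b S) (0, β.2) (G u) -
        derivOn (cylinder t₀ a b S) (0, β.2) (G v)) z := by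
  have hΩ := cylinder_subset_closure_interior (t₀ := t₀) ha hb hSint
  rw [((isJet_picard ha hb hS hSint hi hGu).sub
    (isJet_picard ha hb hS hSint hi hGv)).derivOn_eq hΩ hβ hz,
    iterIntT_sub ha hb ((hGu.isJet hΩ).2.1 0 β.2 le_rfl) ((hGv.isJet hΩ).2.1 0 β.2 le_rfl) _ hz]
  simp

/-- The right-hand side is bounded by `M_k`, hence `∂_x^α ∂_t^γ (P(u) - i₀) = I_{d-γ}[∂_x^α G(u)]`
is bounded by the integrals of `M_k`. -/
theorem picard_mem_gradedBall (hp : p < d) (ha : 0 < a) (hb : 0 < b) (hS : IsCompact S)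
    (hSint : S ⊆ closure (interior S)) (hi : IsJet (cylinder t₀ a b S) d i₀ D)
    (hG : SepRegular (cylinder t₀ a b S) 0 (G u)) {M : ℕ → ℝ × (Fin s → ℝ) → ℝ}
    (hM : ∀ k, ContinuousOn (M k) (cylinder t₀ a b S))
    (hGM : ∀ k, ∀ z ∈ cylinder t₀ a b S, ∀ ν ∈ spaceIdx s k,
      ‖derivOn (cylinder t₀ a b S) (0, ν) (G u) z‖ ≤ M k z)
    (hMr : ∀ k, (⨆ z ∈ cylinder t₀ a b S, ⨆ j : Fin d,
      ENNReal.ofReal (boundIter t₀ (M k) (j.val + 1) z)) ≤ r k) :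
    picard t₀ d i₀ G u ∈ gradedBall (cylinder t₀ a b S) p r i₀ := by
  refine ⟨((isJet_picard ha hb hS hSint hi hG).mono hp.le).sepRegular,
    fun k => gradedNorm_le_iff.2 fun β h1 h2 z hz => ?_⟩
  rw [derivOn_picard_sub_initial ha hb hS hSint hi hG (h1.trans hp.le) hz, ← ofReal_norm]
  have hβ : β.2 ∈ spaceIdx s k := mem_spaceIdx.2 (by lia)
  refine (ENNReal.ofReal_le_ofReal (norm_iterIntT_le ha hb (hM k)
    (fun w hw => hGM k w hw _ hβ) (d - β.1) hz)).trans (le_trans ?_ (hMr k))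
  have hd : d - β.1 = (⟨d - β.1 - 1, by lia⟩ : Fin d).val + 1 := by simp only; lia
  rw [hd]
  exact le_iSup₂_of_le z hz (le_iSup_of_le (⟨d - β.1 - 1, by lia⟩ : Fin d) le_rfl)

/-! ### The Lipschitz estimate for the Picard iterates -/

/-- `max_{0<l≤d} Λ_{k,n}^l`. -/
noncomputable def lipSup (t₀ : ℝ) (d L : ℕ) (Λ : ℕ → ℝ × (Fin s → ℝ) → ℝ) (n k : ℕ)
    (z : ℝ × (Fin s → ℝ)) : ℝ :=
  ⨆ l : Fin d, lipIter t₀ d L Λ n k (l.val + 1) z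

theorem lipIter_succ (n k j : ℕ) (z : ℝ × (Fin s → ℝ)) : lipIter t₀ d L Λ (n + 1) k j z =
    |iterIntT t₀ j (fun w => Λ k w * lipSup t₀ d L Λ n (k + L) w) z| := rfl

theorem lipIter_nonneg (n k j : ℕ) (z : ℝ × (Fin s → ℝ)) : 0 ≤ lipIter t₀ d L Λ n k j z := by
  cases n with
  | zero => exact zero_le_one
  | succ n => exact abs_nonneg _

theorem lipSup_nonneg (n k : ℕ) (z : ℝ × (Fin s → ℝ)) : 0 ≤ lipSup t₀ d L Λ n k z :=
  Real.iSup_nonneg fun _ => lipIter_nonneg _ _ _ _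

theorem lipIter_le_lipSup (n k : ℕ) {j : ℕ} (h0 : 0 < j) (hj : j ≤ d) (z : ℝ × (Fin s → ℝ)) :
    lipIter t₀ d L Λ n k j z ≤ lipSup t₀ d L Λ n k z := by
  obtain ⟨j, rfl⟩ : ∃ i, j = i + 1 := ⟨j - 1, by lia⟩
  exact le_ciSup (f := fun l : Fin d => lipIter t₀ d L Λ n k (l.val + 1) z)
    (Finite.bddAbove_range _) ⟨j, hj⟩

theorem lipSup_zero (hd : 0 < d) (k : ℕ) (z : ℝ × (Fin s → ℝ)) : lipSup t₀ d L Λ 0 k z = 1 := by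
  have : Nonempty (Fin d) := ⟨⟨0, hd⟩⟩
  exact ciSup_const

theorem ofReal_lipSup_le_lipBar {Ω : Set (ℝ × (Fin s → ℝ))} (hd : 0 < d) (n k : ℕ)
    {z : ℝ × (Fin s → ℝ)} (hz : z ∈ Ω) :
    ENNReal.ofReal (lipSup t₀ d L Λ n k z) ≤ lipBar Ω t₀ d L Λ k n := by
  have : Nonempty (Fin d) := ⟨⟨0, hd⟩⟩
  obtain ⟨l, hl⟩ := exists_eq_ciSup_of_finite
    (f := fun l : Fin d => lipIter t₀ d L Λ n k (l.val + 1) z)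
  rw [lipSup, ← hl]
  exact le_iSup₂_of_le z hz (le_iSup_of_le l le_rfl)

theorem continuousOn_lipSup (ha : 0 < a) (hb : 0 < b) (hd : 0 < d)
    (hΛ : ∀ k, ContinuousOn (Λ k) (cylinder t₀ a b S)) (n k : ℕ) :
    ContinuousOn (lipSup t₀ d L Λ n k) (cylinder t₀ a b S) := by
  have : Nonempty (Fin d) := ⟨⟨0, hd⟩⟩
  induction n generalizing k with
  | zero => exact continuousOn_const.congr fun z _ => lipSup_zero hd k z
  | succ n ih =>
    have hc : ∀ j, ContinuousOn (lipIter t₀ d L Λ (n + 1) k j) (cylinder t₀ a b S) := fun j =>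
      (continuousOn_iterIntT ha hb ((hΛ k).mul (ih (k + L))) j).abs
    refine (ContinuousOn.finset_sup'_apply Finset.univ_nonempty
      fun (l : Fin d) _ => hc (l.val + 1)).congr fun z _ => ?_
    beta_reduce
    rw [lipSup, Finset.sup'_univ_eq_ciSup]

theorem sup_nnnorm_derivOn_le {Ω : Set (ℝ × (Fin s → ℝ))} {w : ℝ × (Fin s → ℝ) → (Fin m → ℝ)}
    {K : ℕ} {z : ℝ × (Fin s → ℝ)} {c : ℝ} (h : ∀ β ∈ jetIdx s p K, ‖derivOn Ω β w z‖ ≤ c) :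
    (((jetIdx s p K).sup fun β => ‖derivOn Ω β w z‖₊ : ℝ≥0) : ℝ) ≤ c := by
  have hc : 0 ≤ c := (norm_nonneg _).trans (h _ (zero_mem_jetIdx K))
  lift c to ℝ≥0 using hc
  exact_mod_cast Finset.sup_le fun β hβ => NNReal.coe_le_coe.1 (h β hβ)

/-- Lipschitz factors are nonnegative unless the ball contains, up to the values outside `Ω`, its
centre only: if `u` belongs to the ball and `u - i₀` has the value `c ≠ 0` at a point of `Ω`, then
`i₀ + c` belongs to the ball as well, and the Lipschitz condition is applied to `i₀ + c` and `i₀`.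
The second alternative does occur, when the radii are not bounded away from `0`. -/
theorem lipschitz_nonneg_or_ball_trivial {Ω : Set (ℝ × (Fin s → ℝ))}
    (hΩ : Ω ⊆ closure (interior Ω)) (hi : SepRegular Ω p i₀)
    (hΛ : LipschitzLOD Ω p L (gradedBall Ω p r i₀) G Λ) :
    (∀ k, ∀ z ∈ Ω, 0 ≤ Λ k z) ∨ ∀ u ∈ gradedBall Ω p r i₀, EqOn u i₀ Ω := by
  by_contra! hcon
  obtain ⟨⟨k, z, hz, hneg⟩, u, hu, hne⟩ := hcon
  obtain ⟨w, hw, hne⟩ : ∃ w ∈ Ω, u w ≠ i₀ w := by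
    by_contra! h
    exact hne fun w hw => h w hw
  set c := u w - i₀ w with hc
  have hc0 : c ≠ 0 := sub_ne_zero.2 hne
  have hJc : IsJet Ω p (fun _ => c) (fun β _ => if β = 0 then c else 0) := IsJet.const c
  have hsub : (i₀ + fun _ => c) - i₀ = fun _ => c := by ext; simp
  have hcr : ∀ k, ‖c‖ₑ ≤ r k := by
    intro k
    have h1 := gradedNorm_le_iff.1 (hu.2 k) (0, 0) (Nat.zero_le p) (by simp) w hw
    have h2 : derivOn Ω (0, 0) (u - i₀) w = c := ((hu.1.sub hi).isJet hΩ).1 hw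
    rwa [h2] at h1
  have hv : (i₀ + fun _ => c) ∈ gradedBall Ω p r i₀ := by
    refine ⟨((hi.isJet hΩ).add hJc).sepRegular,
      fun k => gradedNorm_le_iff.2 fun β h1 _ x hx => ?_⟩
    rw [hsub, hJc.derivOn_eq hΩ h1 hx]
    beta_reduce
    split_ifs
    · exact hcr k
    · simp
  have h0 : (0 : Fin s → ℕ) ∈ spaceIdx s k := mem_spaceIdx.2 (by simp)
  have h1 := (norm_nonneg _).trans (hΛ.2.2 k 0 h0 _ hv _ (mem_gradedBall_self hΩ hi) z hz)
  rw [hsub] at h1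
  have h2 : ‖c‖₊ ≤ (jetIdx s p (k + L)).sup fun β => ‖derivOn Ω β (fun _ => c) z‖₊ := by
    refine le_trans (le_of_eq ?_)
      (Finset.le_sup (f := fun β => ‖derivOn Ω β (fun _ => c) z‖₊) (zero_mem_jetIdx (k + L)))
    rw [hJc.derivOn_eq hΩ (β := (0, 0)) (Nat.zero_le p) hz]
    simp
  have h3 : 0 < ‖c‖₊ := nnnorm_pos.2 hc0
  have h4 : (0 : ℝ) <
      (((jetIdx s p (k + L)).sup fun β => ‖derivOn Ω β (fun _ => c) z‖₊ : ℝ≥0) : ℝ) :=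
    NNReal.coe_pos.2 (h3.trans_le h2)
  exact absurd h1 (not_le.2 (mul_neg_of_neg_of_pos hneg h4))

/-- The increments of the Picard iterates: each step integrates the Lipschitz estimate for the
right-hand side, at the cost of `L` space derivatives. -/
theorem norm_derivOn_picard_iterate_sub_le (hp : p < d) (ha : 0 < a) (hb : 0 < b)
    (hS : IsCompact S) (hSint : S ⊆ closure (interior S))
    (hi : IsJet (cylinder t₀ a b S) d i₀ D)
    (hΛ : LipschitzLOD (cylinder t₀ a b S) p L (gradedBall (cylinder t₀ a b S) p r i₀) G Λ)
    (hmem : ∀ n, (picard t₀ d i₀ G)^[n] i₀ ∈ gradedBall (cylinder t₀ a b S) p r i₀)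
    {C : ℕ → ℝ} (hC : ∀ K, ∀ β ∈ jetIdx s p K, ∀ z ∈ cylinder t₀ a b S,
      ‖derivOn (cylinder t₀ a b S) β (picard t₀ d i₀ G i₀ - i₀) z‖ ≤ C K) (n : ℕ) :
    ∀ k, ∀ β ∈ jetIdx s p k, ∀ z ∈ cylinder t₀ a b S,
      ‖derivOn (cylinder t₀ a b S) β
        ((picard t₀ d i₀ G)^[n + 1] i₀ - (picard t₀ d i₀ G)^[n] i₀) z‖ ≤
        lipSup t₀ d L Λ n k z * C (k + n * L) := by
  have hΩ := cylinder_subset_closure_interior (t₀ := t₀) ha hb hSint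
  have hi' : SepRegular (cylinder t₀ a b S) p i₀ := (hi.mono hp.le).sepRegular
  rcases lipschitz_nonneg_or_ball_trivial hΩ hi' hΛ with hpos | htriv
  · induction n with
    | zero =>
      intro k β hβ z hz
      rw [lipSup_zero (by lia), one_mul]
      simpa using hC k β hβ z hz
    | succ n ih =>
      intro k β hβ z hz
      obtain ⟨h1, h2⟩ := mem_jetIdx.1 hβ
      rw [Function.iterate_succ_apply' _ (n + 1), Function.iterate_succ_apply' _ n]
      rw [Function.iterate_succ_apply' _ n] at ih
      have hmem' := hmem (n + 1)
      rw [Function.iterate_succ_apply' _ n] at hmem'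
      set u := (picard t₀ d i₀ G)^[n] i₀ with hu
      rw [derivOn_picard_sub_picard ha hb hS hSint hi (hΛ.1 _ hmem') (hΛ.1 _ (hmem n))
        (h1.trans hp.le) hz]
      have hbound : ∀ w ∈ cylinder t₀ a b S,
          ‖(derivOn (cylinder t₀ a b S) (0, β.2) (G (picard t₀ d i₀ G u)) -
            derivOn (cylinder t₀ a b S) (0, β.2) (G u)) w‖ ≤
            Λ k w * lipSup t₀ d L Λ n (k + L) w * C (k + (n + 1) * L) := by
        intro w hw
        refine (hΛ.2.2 k β.2 (mem_spaceIdx.2 h2) _ hmem' _ (hmem n) w hw).trans ?_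
        rw [mul_assoc]
        refine mul_le_mul_of_nonneg_left (sup_nnnorm_derivOn_le fun β' hβ' => ?_) (hpos k w hw)
        have := ih (k + L) β' hβ' w hw
        rwa [show k + L + n * L = k + (n + 1) * L by ring] at this
      have hcont : ContinuousOn (fun w => Λ k w * lipSup t₀ d L Λ n (k + L) w *
          C (k + (n + 1) * L)) (cylinder t₀ a b S) :=
        ((hΛ.2.1 k).mul (continuousOn_lipSup ha hb (by lia) hΛ.2.1 n (k + L))).mul
          continuousOn_const
      have hC0 : 0 ≤ C (k + (n + 1) * L) :=
        (norm_nonneg _).trans (hC _ _ (zero_mem_jetIdx _) z hz)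
      refine (norm_iterIntT_le ha hb hcont hbound (d - β.1) hz).trans ?_
      rw [iterIntT_mul_const, abs_mul, abs_of_nonneg hC0, ← lipIter_succ]
      exact mul_le_mul_of_nonneg_right (lipIter_le_lipSup _ _ (by lia) (by lia) z) hC0
  · intro k β hβ z hz
    have h1 := (mem_jetIdx.1 hβ).1
    rw [derivOn_sub (hmem (n + 1)).1 (hmem n).1 hΩ h1 hz,
      derivOn_congr (htriv _ (hmem (n + 1))) β hz, derivOn_congr (htriv _ (hmem n)) β hz,
      sub_self, norm_zero]
    exact mul_nonneg (lipSup_nonneg _ _ _) ((norm_nonneg _).trans (hC _ _ (zero_mem_jetIdx _) z hz))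

theorem spaceNorm_picard_iterate_sub_le (hp : p < d) (ha : 0 < a) (hb : 0 < b)
    (hS : IsCompact S) (hSint : S ⊆ closure (interior S))
    (hi : IsJet (cylinder t₀ a b S) d i₀ D)
    (hΛ : LipschitzLOD (cylinder t₀ a b S) p L (gradedBall (cylinder t₀ a b S) p r i₀) G Λ)
    (hmem : ∀ n, (picard t₀ d i₀ G)^[n] i₀ ∈ gradedBall (cylinder t₀ a b S) p r i₀) (k n : ℕ) :
    spaceNorm (cylinder t₀ a b S) p k
        ((picard t₀ d i₀ G)^[n + 1] i₀ - (picard t₀ d i₀ G)^[n] i₀) ≤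
      lipBar (cylinder t₀ a b S) t₀ d L Λ k n *
        spaceNorm (cylinder t₀ a b S) p (k + n * L) (picard t₀ d i₀ G i₀ - i₀) := by
  have hΩ := cylinder_subset_closure_interior (t₀ := t₀) ha hb hSint
  have hfin : ∀ K, spaceNorm (cylinder t₀ a b S) p K (picard t₀ d i₀ G i₀ - i₀) ≠ ⊤ := fun K =>
    (spaceNorm_lt_top hΩ (isCompact_cylinder hS) ((hmem 1).1.sub (hmem 0).1) K).ne
  refine spaceNorm_le_iff.2 fun β hβ z hz => ?_
  have key := norm_derivOn_picard_iterate_sub_le hp ha hb hS hSint hi hΛ hmem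
    (C := fun K => (spaceNorm (cylinder t₀ a b S) p K (picard t₀ d i₀ G i₀ - i₀)).toReal)
    (fun K β hβ z hz => by
      rw [← toReal_enorm]
      exact ENNReal.toReal_mono (hfin K) (spaceNorm_le_iff.1 le_rfl β hβ z hz)) n k β hβ z hz
  rw [← ofReal_norm]
  refine (ENNReal.ofReal_le_ofReal key).trans ?_
  rw [ENNReal.ofReal_mul (lipSup_nonneg _ _ _), ENNReal.ofReal_toReal (hfin _)]
  gcongr
  exact ofReal_lipSup_le_lipBar (by lia) n k hz

/-- The Picard operator is continuous along sequences in the ball, so that a limit of Picard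
iterates is a fixed point. -/
theorem tendsto_picard (ha : 0 < a) (hb : 0 < b)
    (hS : IsCompact S) (hSint : S ⊆ closure (interior S))
    (hi : IsJet (cylinder t₀ a b S) d i₀ D)
    (hΛ : LipschitzLOD (cylinder t₀ a b S) p L B G Λ) {f : ℕ → ℝ × (Fin s → ℝ) → (Fin m → ℝ)}
    (hf : ∀ n, f n ∈ B) (hu : u ∈ B)
    (h : Tendsto (fun n => spaceNorm (cylinder t₀ a b S) p L (f n - u)) atTop (𝓝 0))
    {z : ℝ × (Fin s → ℝ)} (hz : z ∈ cylinder t₀ a b S) :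
    Tendsto (fun n => picard t₀ d i₀ G (f n) z) atTop (𝓝 (picard t₀ d i₀ G u z)) := by
  have hΩ := cylinder_subset_closure_interior (t₀ := t₀) ha hb hSint
  obtain ⟨K, hK⟩ := (isCompact_cylinder hS).exists_bound_of_continuousOn (hΛ.2.1 0)
  have hreal : Tendsto (fun n => (spaceNorm (cylinder t₀ a b S) p L (f n - u)).toReal) atTop
      (𝓝 0) := (ENNReal.tendsto_toReal ENNReal.zero_ne_top).comp h
  have hlim : Tendsto (fun n => |iterIntT t₀ d (fun _ : ℝ × (Fin s → ℝ) => (1 : ℝ)) z *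
      (K * (spaceNorm (cylinder t₀ a b S) p L (f n - u)).toReal)|) atTop (𝓝 0) := by
    simpa using ((hreal.const_mul K).const_mul
      (iterIntT t₀ d (fun _ : ℝ × (Fin s → ℝ) => (1 : ℝ)) z)).abs
  rw [tendsto_iff_norm_sub_tendsto_zero]
  refine squeeze_zero' (Eventually.of_forall fun n => norm_nonneg _) ?_ hlim
  filter_upwards [h.eventually (gt_mem_nhds ENNReal.zero_lt_top)] with n hn
  have hbound : ∀ w ∈ cylinder t₀ a b S,
      ‖(derivOn (cylinder t₀ a b S) (0, 0) (G (f n)) -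
        derivOn (cylinder t₀ a b S) (0, 0) (G u)) w‖ ≤
        1 * (K * (spaceNorm (cylinder t₀ a b S) p L (f n - u)).toReal) := by
    intro w hw
    refine (hΛ.2.2 0 0 (mem_spaceIdx.2 (by simp)) _ (hf n) _ hu w hw).trans ?_
    rw [one_mul, zero_add]
    refine mul_le_mul ((le_abs_self _).trans (hK w hw)) (sup_nnnorm_derivOn_le fun β hβ => ?_)
      (NNReal.coe_nonneg _) ((norm_nonneg _).trans (hK w hw))
    rw [← toReal_enorm]
    exact ENNReal.toReal_mono hn.ne (spaceNorm_le_iff.1 le_rfl β hβ w hw)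
  have hval := derivOn_picard_sub_picard ha hb hS hSint hi (hΛ.1 _ (hf n)) (hΛ.1 _ hu)
    (β := (0, 0)) (Nat.zero_le d) hz
  have hreg := (isJet_picard ha hb hS hSint hi (hΛ.1 _ (hf n))).sepRegular.sub
    (isJet_picard ha hb hS hSint hi (hΛ.1 _ hu)).sepRegular
  have hval0 : derivOn (cylinder t₀ a b S) (0, 0)
      (picard t₀ d i₀ G (f n) - picard t₀ d i₀ G u) z =
      picard t₀ d i₀ G (f n) z - picard t₀ d i₀ G u z := (hreg.isJet hΩ).1 hz
  rw [← hval0, hval, ← iterIntT_mul_const]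
  exact norm_iterIntT_le ha hb continuousOn_const hbound _ hz

end Picard

/-! ### The Picard–Lindelöf theorem -/

section CauchyProblem

variable {s m p d L : ℕ} {t₀ a b : ℝ} {S : Set (Fin s → ℝ)}
  {F : ℝ × (Fin s → ℝ) × (jetIdx s p L → (Fin m → ℝ)) → (Fin m → ℝ)}
  {y₀ : Fin d → (Fin s → ℝ) → (Fin m → ℝ)} {y : ℝ × (Fin s → ℝ) → (Fin m → ℝ)}
  {D : ℕ × (Fin s → ℕ) → ℝ × (Fin s → ℝ) → (Fin m → ℝ)}

/-- A fixed point of the Picard operator solves the Cauchy problem and is smooth up to the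
boundary. -/
theorem isCauchySolution_of_fixedPoint (hp : p < d) (ha : 0 < a) (hb : 0 < b)
    (hS : IsCompact S) (hSint : S ⊆ closure (interior S))
    (hF : SmoothUpTo (rhsDomain m p L t₀ a b S) F)
    (hD : IsJet (cylinder t₀ a b S) d (initialPoly t₀ y₀) D)
    (hDd : ∀ α z, D (d, α) z = 0) (hD₀ : ∀ j : Fin d, ∀ x ∈ S, D (j, 0) (t₀, x) = y₀ j x)
    (hG : SepRegular (cylinder t₀ a b S) 0 (rhs (cylinder t₀ a b S) F y))
    (hfix : EqOn (picard t₀ d (initialPoly t₀ y₀) (rhs (cylinder t₀ a b S) F) y) y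
      (cylinder t₀ a b S)) :
    SmoothUpTo (cylinder t₀ a b S) y ∧ IsCauchySolution t₀ a b S F y₀ y := by
  have hΩ := cylinder_subset_closure_interior (t₀ := t₀) ha hb hSint
  have hJ := (isJet_picard ha hb hS hSint hD hG).congr hfix
  have hE := hG.isJet hΩ
  refine ⟨smoothUpTo_of_isJet hΩ hp hJ hE hF.jetDomain_of_rhsDomain (fun z hz => ?_)
    fun α z _ => ?_, fun z hz => ?_, fun j x hx => ?_⟩
  · have : ∀ β : jetIdx s p L, derivOn (cylinder t₀ a b S) β.1 y z = _ := fun β =>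
      hJ.derivOn_eq hΩ ((mem_jetIdx.1 β.2).1.trans hp.le) hz
    simp only [rhs, this]
  · simp [hDd]
  · rw [hJ.derivOn_eq hΩ le_rfl hz]
    simp only [Pi.add_apply, hDd, zero_add, Nat.sub_self, iterIntT_zero]
    exact hE.1 hz
  · have hz : (t₀, x) ∈ cylinder t₀ a b S := ⟨⟨by linarith, by linarith⟩, hx⟩
    obtain ⟨n, hn⟩ : ∃ n, d - (j : ℕ) = n + 1 := ⟨d - j - 1, by lia⟩
    rw [hJ.derivOn_eq hΩ (β := ((j : ℕ), 0)) j.2.le hz]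
    simp [hn, hD₀ j x hx, iterIntT_succ_initial]

end CauchyProblem

theorem mainTheorem1 {s m d p L : ℕ} (hp : p < d) (t₀ a b : ℝ) (ha : 0 < a) (hb : 0 < b)
    (S : Set (Fin s → ℝ)) (hS : IsCompact S) (hSint : S ⊆ closure (interior S))
    (F : ℝ × (Fin s → ℝ) × (jetIdx s p L → (Fin m → ℝ)) → (Fin m → ℝ))
    (hF : SmoothUpTo (rhsDomain m p L t₀ a b S) F)
    (y₀ : Fin d → (Fin s → ℝ) → (Fin m → ℝ)) (hy₀ : ∀ j, SmoothUpTo S (y₀ j))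
    (r : ℕ → ℝ≥0∞) (hr : ∀ k, 0 < r k)
    (Ω : Set (ℝ × (Fin s → ℝ))) (hΩ : Ω = cylinder t₀ a b S)
    (i₀ : ℝ × (Fin s → ℝ) → (Fin m → ℝ)) (hi₀ : i₀ = initialPoly t₀ y₀)
    (B : Set (ℝ × (Fin s → ℝ) → (Fin m → ℝ))) (hB : B = gradedBall Ω p r i₀)
    (P : (ℝ × (Fin s → ℝ) → (Fin m → ℝ)) → ℝ × (Fin s → ℝ) → (Fin m → ℝ))
    (hP : P = picard t₀ d i₀ (rhs Ω F))
    (Λ : ℕ → ℝ × (Fin s → ℝ) → ℝ) (hΛ : LipschitzLOD Ω p L B (rhs Ω F) Λ) :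
    -- `P` is a map from the ball to `C_t^p C_x^∞`
    (∀ u ∈ B, SepRegular Ω p (P u)) ∧
    -- convergence of the Picard iterates to a smooth solution
    ((∀ n : ℕ, P^[n] i₀ ∈ B) →
      (∀ k : ℕ,
        (∑' n : ℕ, lipBar Ω t₀ d L Λ k n * spaceNorm Ω p (k + n * L) (P i₀ - i₀)) < ⊤) →
      ∃ y ∈ B, SmoothUpTo Ω y ∧ IsCauchySolution t₀ a b S F y₀ y ∧
        (∀ k : ℕ, Tendsto (fun n : ℕ => gradedNorm Ω p k (P^[n] i₀ - y)) atTop (𝓝 0)) ∧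
        ∀ k N : ℕ, spaceNorm Ω p k (y - P^[N] i₀) ≤
          ∑' n : ℕ, lipBar Ω t₀ d L Λ k (N + n) *
            spaceNorm Ω p (k + (N + n) * L) (P i₀ - i₀)) ∧
    -- the criterion for `P` to map the ball to itself
    (∀ M : ℕ → ℝ × (Fin s → ℝ) → ℝ, (∀ k, ContinuousOn (M k) Ω) →
      (∀ k : ℕ, ∀ u ∈ B, ∀ z ∈ Ω, ∀ ν ∈ spaceIdx s k,
        ‖derivOn Ω (0, ν) (rhs Ω F u) z‖ ≤ M k z) →
      (∀ k : ℕ,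
        (⨆ z ∈ Ω, ⨆ j : Fin d, ENNReal.ofReal (boundIter t₀ (M k) (j.val + 1) z)) ≤ r k) →
      (∀ u ∈ B, P u ∈ B) ∧ ∀ n : ℕ, P^[n] i₀ ∈ B) := by
  subst hΩ hi₀ hB hP
  have hcl := cylinder_subset_closure_interior (t₀ := t₀) ha hb hSint
  obtain ⟨D, hD, hDd, hD₀⟩ :=
    exists_isJet_initialPoly (t₀ := t₀) (a := a) (b := b) hSint hy₀
  have hi : SepRegular (cylinder t₀ a b S) p (initialPoly t₀ y₀) := (hD p).sepRegular
  refine ⟨fun u hu => ((isJet_picard ha hb hS hSint (hD d) (hΛ.1 u hu)).mono hp.le).sepRegular,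
    fun hmem hsum => ?_, fun M hM hGM hMr => ?_⟩
  · set Ω := cylinder t₀ a b S with hΩ
    set P := picard t₀ d (initialPoly t₀ y₀) (rhs Ω F) with hP
    obtain ⟨y, hy, htail⟩ := exists_limit_of_summable_increments hcl (fun n => (hmem n).1)
      (spaceNorm_picard_iterate_sub_le hp ha hb hS hSint (hD d) hΛ hmem)
      fun k => (hsum k).ne
    have hlim : ∀ k, Tendsto (fun n => spaceNorm Ω p k (y - P^[n] (initialPoly t₀ y₀))) atTop
        (𝓝 0) := fun k =>
      tendsto_of_tendsto_of_tendsto_of_le_of_le tendsto_const_nhds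
        (tendsto_tsum_tail (hsum k).ne) (fun _ => zero_le) (htail k)
    have hyB : y ∈ gradedBall Ω p r (initialPoly t₀ y₀) :=
      mem_gradedBall_of_tendsto hcl hi hmem hy hlim
    have hlim' : ∀ k, Tendsto (fun n => spaceNorm Ω p k (P^[n] (initialPoly t₀ y₀) - y)) atTop
        (𝓝 0) := fun k =>
      (hlim k).congr fun n => spaceNorm_sub_comm hcl hy (hmem n).1 k
    have hfix : EqOn (P y) y Ω := by
      intro z hz
      have h1 := tendsto_picard ha hb hS hSint (hD d) hΛ hmem hyB (hlim' L) hz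
      have h2 := tendsto_derivOn_of_spaceNorm hcl (fun n => (hmem n).1) hy (hlim 0)
        (zero_mem_jetIdx 0) hz
      rw [show derivOn Ω (0, 0) y z = y z from (hy.isJet hcl).1 hz] at h2
      refine tendsto_nhds_unique h1 ((h2.comp (tendsto_add_atTop_nat 1)).congr fun n => ?_)
      rw [← hP, ← Function.iterate_succ_apply' P]
      exact ((hmem (n + 1)).1.isJet hcl).1 hz
    obtain ⟨hsmooth, hsol⟩ := isCauchySolution_of_fixedPoint hp ha hb hS hSint hF (hD d) hDd hD₀
      (hΛ.1 y hyB) hfix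
    exact ⟨y, hyB, hsmooth, hsol, fun k => tendsto_of_tendsto_of_tendsto_of_le_of_le
      tendsto_const_nhds (hlim' k) (fun _ => zero_le) fun n => gradedNorm_le_spaceNorm k, htail⟩
  · have hmap : ∀ u ∈ gradedBall (cylinder t₀ a b S) p r (initialPoly t₀ y₀),
        picard t₀ d (initialPoly t₀ y₀) (rhs (cylinder t₀ a b S) F) u ∈
          gradedBall (cylinder t₀ a b S) p r (initialPoly t₀ y₀) := fun u hu =>
      picard_mem_gradedBall hp ha hb hS hSint (hD d) (hΛ.1 u hu) hM
        (fun k z hz ν hν => hGM k u hu z hz ν hν) hMr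
    refine ⟨hmap, fun n => ?_⟩
    induction n with
    | zero => exact mem_gradedBall_self hcl hi
    | succ n ih =>
      rw [Function.iterate_succ_apply']
      exact hmap _ ih
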